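/- For $n\ge 1$ and a set $X\subset\mathbb R^n\times\mathbb R$, the Laguerre cell of $(v,h)\in X$ is $C((v,h),X)=\{w\in\mathbb R^n:\ \|w-v\|^2+h\le\|w-v'\|^2+h'\text{ for all }(v',h')\in X\}$, and the Laguerre diagram $\mathcal L(X)$ is the collection of all non-empty sets among the cells $C((v,h),X)$, $(v,h)\in X$. Define the following random tessellations of $\mathbb R^n$. (a) For $\beta>-1$ and $\gamma>0$, the $\beta$-Voronoi tessellation $\mathcal V_{n,\beta,\gamma}$ is $\mathcal L(\eta)$, where $\eta$ is a Poisson point process on $\mathbb R^n\times[0,\infty)$ whose intensity measure has Lebesgue density $\gamma\,\frac{\Gamma(\frac{n+1}2+\beta+1)}{\pi^{(n+1)/2}\,\Gamma(\beta+1)}\,h^{\beta}$ at $(v,h)$. For $\beta=-1$, $\mathcal V_{n,-1,\gamma}$ is the Voronoi tessellation of a homogeneous Poisson point process on $\mathbb R^n$ with intensity $\gamma\,\Gamma(\frac{n+1}2)\,\pi^{-\frac{n+1}2}$. (b) For $\beta>\frac n2+1$ and $\gamma>0$, the $\beta'$-Voronoi tessellation $\mathcal V'_{n,\beta,\gamma}$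 is $\mathcal L(\eta')$, where $\eta'$ is a Poisson point process on $\mathbb R^n\times(-\infty,0)$ whose intensity measure has Lebesgue density $\gamma\,\frac{\Gamma(\beta)}{\pi^{(n+1)/2}\,\Gamma(\beta-\frac{n+1}2)}\,(-h)^{-\beta}$ at $(v,h)$. (c) For $\lambda>0$, the Gaussian-Voronoi tessellation $\mathcal G_{n,\lambda}$ is $\mathcal L(\zeta)$, where $\zeta$ is a Poisson point process on $\mathbb R^n\times\mathbb R$ whose intensity measure has Lebesgue density $\gamma e^{\lambda h}$ at $(v,h)$, with an arbitrary constant $\gamma>0$ (the distribution of $\mathcal L(\zeta)$ does not depend on $\gamma$). Fix integers $d\ge2$ and $1\le\ell\le d-1$, and identify $\mathbb R^\ell$ with the span of the first $\ell$ standard basis vectors of $\mathbb R^d$. For a collection $T$ of closed subsets of $\mathbb R^d$, let $T\cap\mathbb R^\ell$ be the collection of the non-empty sets among the $c\cap\mathbb R^\ell$, $c\in T$. The distribution of a random collection of closed sets is understood with respect to the $\sigma$-algebra generated by the numbers of its members lying in measurable sets of closed sets (measurable for the Borel $\sigma$-algebra of the Fell topology). **Theorem.** (i) For all $\beta\ge-1$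 and $\gamma>0$, $\mathcal V_{d,\beta,\gamma}\cap\mathbb R^\ell$ has the same distribution as $\mathcal V_{\ell,\,\beta+\frac{d-\ell}2,\,\gamma}$. (ii) For all $\beta>\frac d2+1$ and $\gamma>0$, $\mathcal V'_{d,\beta,\gamma}\cap\mathbb R^\ell$ has the same distribution as $\mathcal V'_{\ell,\,\beta-\frac{d-\ell}2,\,\gamma}$. (iii) For all $\lambda>0$, $\mathcal G_{d,\lambda}\cap\mathbb R^\ell$ has the same distribution as $\mathcal G_{\ell,\lambda}$. -/

import Mathlib

open MeasureTheory ProbabilityTheory TopologicalSpace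
open scoped ENNReal NNReal

noncomputable section

/-! ### Point configurations and Poisson point processes -/

/-- A configuration of points of `S`, that is, a (multiplicity-free) set of points. -/
@[ext]
structure Config (S : Type*) where
  pts : Set S

/-- The number of points of the configuration `X` in `B`. -/
def Config.count {S : Type*} (X : Config S) (B : Set S) : ℕ∞ :=
  (X.pts ∩ B).encard

/-- The `σ`-algebra generated by the counting variables `X ↦ #(X ∩ B)`, `B` measurable. -/
instance Config.instMeasurableSpace {S : Type*} [MeasurableSpace S] :
    MeasurableSpace (Config S) :=
  ⨆ (B : Set S) (_ : MeasurableSet B), (⊤ : MeasurableSpace ℕ∞).comap (fun X => X.count B)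

/-- The Poisson distribution on `ℕ ∪ {∞}` with mean `a ∈ [0, ∞]`; for `a = ∞` it is the point mass
at `∞`. -/
def poissonLaw (a : ℝ≥0∞) : Measure ℕ∞ :=
  if a = ∞ then Measure.dirac ⊤ else (poissonMeasure a.toNNReal).map (fun n : ℕ => (n : ℕ∞))

/-- `ξ` is a Poisson point process on `S` with intensity measure `μ`, under the probability
measure `P`. (All the intensity measures used below are `σ`-finite and have no atoms.) -/
structure IsPoissonProcess {S Ω : Type*} [MeasurableSpace S] [MeasurableSpace Ω]
    (μ : Measure S) (ξ : Ω → Config S) (P : Measure Ω) : Prop where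
  measurable : Measurable ξ
  law_count : ∀ B : Set S, MeasurableSet B → P.map (fun ω => (ξ ω).count B) = poissonLaw (μ B)
  indep : ∀ (n : ℕ) (B : Fin n → Set S), (∀ i, MeasurableSet (B i)) →
    Pairwise (fun i j => Disjoint (B i) (B j)) →
    iIndepFun (fun i ω => (ξ ω).count (B i)) P

/-! ### Collections of closed sets -/

/-- The Borel `σ`-algebra of the Fell topology on the closed subsets of `E`: it is generated by the
events that a closed set hits a given open set. -/
instance closedsMeasurableSpace {E : Type*} [TopologicalSpace E] : MeasurableSpace (Closeds E) :=
  MeasurableSpace.generateFrom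
    {A | ∃ G : Set E, IsOpen G ∧ A = {F : Closeds E | ((F : Set E) ∩ G).Nonempty}}

/-- Euclidean space `ℝ^d`. -/
abbrev Euc (d : ℕ) : Type := EuclideanSpace ℝ (Fin d)

/-- The space of collections of closed subsets of `ℝ^d` (identified with the point
configurations in the space of closed sets); the tessellations of `ℝ^d`, given as the
collections of their cells, are elements of it. It carries the usual `σ`-algebra of particle
processes, generated by the numbers of cells that lie in a measurable set of closed sets. -/
abbrev Collection (d : ℕ) : Type := Config (Closeds (Euc d))

/-! ### Laguerre and Voronoi diagrams -/

/-- The power of `w` with respect to the point `x.1` with height `x.2`. -/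
def power {d : ℕ} (w : Euc d) (x : Euc d × ℝ) : ℝ := ‖w - x.1‖ ^ 2 + x.2

/-- The Laguerre cell `{w | pow(w, x) ≤ pow(w, y) for all y ∈ X}` of `x` with respect to `X`. -/
def laguerreCell {d : ℕ} (x : Euc d × ℝ) (X : Config (Euc d × ℝ)) : Closeds (Euc d) where
  carrier := {w | ∀ y ∈ X.pts, power w x ≤ power w y}
  isClosed' := by
    have h : {w : Euc d | ∀ y ∈ X.pts, power w x ≤ power w y}
        = ⋂ y ∈ X.pts, {w | power w x ≤ power w y} := by ext; simp
    rw [h]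
    refine isClosed_biInter fun y _ => isClosed_le ?_ ?_ <;> unfold power <;> fun_prop

/-- The Laguerre diagram of `X`: the collection of the non-empty Laguerre cells. -/
def laguerre {d : ℕ} (X : Config (Euc d × ℝ)) : Collection d where
  pts := {C | (C : Set (Euc d)).Nonempty ∧ ∃ x ∈ X.pts, C = laguerreCell x X}

/-- The Voronoi cell of `v` with respect to `Y`. -/
def voronoiCell {d : ℕ} (v : Euc d) (Y : Config (Euc d)) : Closeds (Euc d) where
  carrier := {w | ∀ y ∈ Y.pts, ‖w - v‖ ≤ ‖w - y‖}
  isClosed' := by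
    have h : {w : Euc d | ∀ y ∈ Y.pts, ‖w - v‖ ≤ ‖w - y‖}
        = ⋂ y ∈ Y.pts, {w | ‖w - v‖ ≤ ‖w - y‖} := by ext; simp
    rw [h]
    exact isClosed_biInter fun y _ => isClosed_le (by fun_prop) (by fun_prop)

/-- The Voronoi diagram of `Y`: the collection of the Voronoi cells of the points of `Y`. -/
def voronoi {d : ℕ} (Y : Config (Euc d)) : Collection d where
  pts := {C | ∃ v ∈ Y.pts, C = voronoiCell v Y}

/-! ### Sections with a coordinate subspace -/

/-- For `ℓ ≤ d`, the embedding of `ℝ^ℓ` in `ℝ^d` as the span of the first `ℓ` standard basis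
vectors. -/
def embed (ℓ d : ℕ) (x : Euc ℓ) : Euc d :=
  WithLp.toLp 2 (fun i : Fin d => if h : (i : ℕ) < ℓ then x ⟨i, h⟩ else 0)

theorem continuous_embed (ℓ d : ℕ) : Continuous (embed ℓ d) := by
  refine (PiLp.continuous_toLp 2 _).comp (continuous_pi fun i => ?_)
  by_cases h : (i : ℕ) < ℓ
  · simp only [h, dite_true]; fun_prop
  · simp only [h, dite_false]; fun_prop

/-- The section of a collection `T` of closed subsets of `ℝ^d` with `ℝ^ℓ`: the non-empty sets among
the `c ∩ ℝ^ℓ`, `c ∈ T`, regarded as subsets of `ℝ^ℓ`. -/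
def sectionWith (ℓ : ℕ) {d : ℕ} (T : Collection d) : Collection ℓ where
  pts := {C | (C : Set (Euc ℓ)).Nonempty ∧ ∃ c ∈ T.pts, C = c.preimage (continuous_embed ℓ d)}

/-! ### The three families of random tessellations -/

/-- The constant `c_{n, β} = Γ(n/2 + β + 1) / (π^(n/2) Γ(β + 1))`. -/
def betaConst (n : ℕ) (β : ℝ) : ℝ :=
  Real.Gamma ((n : ℝ) / 2 + β + 1) / (Real.pi ^ ((n : ℝ) / 2) * Real.Gamma (β + 1))

/-- The constant `c'_{n, β} = Γ(β) / (π^(n/2) Γ(β - n/2))`. -/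
def betaPrimeConst (n : ℕ) (β : ℝ) : ℝ :=
  Real.Gamma β / (Real.pi ^ ((n : ℝ) / 2) * Real.Gamma (β - (n : ℝ) / 2))

/-- The constant `r(d) = Γ((d+1)/2) π^(-(d+1)/2)`. -/
def voronoiConst (d : ℕ) : ℝ :=
  Real.Gamma (((d : ℝ) + 1) / 2) * Real.pi ^ (-(((d : ℝ) + 1) / 2))

/-- The measure on `ℝ^d × [0, ∞)` with density `γ c_{d+1, β} h^β`. -/
def betaIntensity (d : ℕ) (β γ : ℝ) : Measure (Euc d × ℝ) :=
  (volume.restrict {x : Euc d × ℝ | 0 ≤ x.2}).withDensity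
    (fun x => ENNReal.ofReal (γ * betaConst (d + 1) β * x.2 ^ β))

/-- The measure on `ℝ^d × (-∞, 0)` with density `γ c'_{d+1, β} (-h)^(-β)`. -/
def betaPrimeIntensity (d : ℕ) (β γ : ℝ) : Measure (Euc d × ℝ) :=
  (volume.restrict {x : Euc d × ℝ | x.2 < 0}).withDensity
    (fun x => ENNReal.ofReal (γ * betaPrimeConst (d + 1) β * (-x.2) ^ (-β)))

/-- The measure on `ℝ^d × ℝ` with density `γ e^(λ h)`. -/
def gaussianIntensity (d : ℕ) (lam γ : ℝ) : Measure (Euc d × ℝ) :=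
  volume.withDensity (fun x => ENNReal.ofReal (γ * Real.exp (lam * x.2)))

section Families

variable {Ω : Type*} [MeasurableSpace Ω]

/-- `T` is the Poisson-Voronoi tessellation of `ℝ^d` with intensity `ρ`. -/
def IsPoissonVoronoi (d : ℕ) (ρ : ℝ) (T : Ω → Collection d) (P : Measure Ω) : Prop :=
  ∃ ζ : Ω → Config (Euc d),
    IsPoissonProcess (ENNReal.ofReal ρ • (volume : Measure (Euc d))) ζ P ∧
    ∀ ω, T ω = voronoi (ζ ω)

/-- `T` is the `β`-Voronoi tessellation of `ℝ^d` with parameters `β ≥ -1` and `γ > 0`; for `β = -1`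
this is, by convention, the Poisson-Voronoi tessellation of intensity `r(d) γ`. -/
def IsBetaVoronoi (d : ℕ) (β γ : ℝ) (T : Ω → Collection d) (P : Measure Ω) : Prop :=
  (β = -1 ∧ IsPoissonVoronoi d (voronoiConst d * γ) T P) ∨
  (-1 < β ∧ ∃ ξ : Ω → Config (Euc d × ℝ),
    IsPoissonProcess (betaIntensity d β γ) ξ P ∧ ∀ ω, T ω = laguerre (ξ ω))

/-- `T` is the `β'`-Voronoi tessellation of `ℝ^d` with parameters `β > d/2 + 1` and `γ > 0`. -/
def IsBetaPrimeVoronoi (d : ℕ) (β γ : ℝ) (T : Ω → Collection d) (P : Measure Ω) : Prop :=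
  ∃ ξ : Ω → Config (Euc d × ℝ),
    IsPoissonProcess (betaPrimeIntensity d β γ) ξ P ∧ ∀ ω, T ω = laguerre (ξ ω)

/-- `T` is the Gaussian-Voronoi tessellation of `ℝ^d` with parameter `λ > 0`, constructed with an
arbitrary constant `γ > 0` (which has no influence on its distribution). -/
def IsGaussianVoronoi (d : ℕ) (lam : ℝ) (T : Ω → Collection d) (P : Measure Ω) : Prop :=
  ∃ γ : ℝ, 0 < γ ∧ ∃ ξ : Ω → Config (Euc d × ℝ),
    IsPoissonProcess (gaussianIntensity d lam γ) ξ P ∧ ∀ ω, T ω = laguerre (ξ ω)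

end Families

end

/-! For `w` in `ℝ^ℓ` and a weighted point `(v, h)` with `v = (v₁, v₂)`, Pythagoras gives `‖w - v‖² +
h = ‖w - v₁‖² + (‖v₂‖² + h)`. Hence the section of a Laguerre diagram is the Laguerre diagram of the
image points `(v₁, ‖v₂‖² + h)` (`power_embed`, `sectionWith_laguerre`). By the mapping theorem
(`IsPoissonProcess.mapOn`) these again form a Poisson process. With `m = d - ℓ`, its intensity is
Lebesgue measure on `ℝ^ℓ` times the convolution of the height density with `π^(m/2) / Γ(m/2) *
r^(m/2 - 1)`, the density of `‖v₂‖²` under Lebesgue measure on `ℝ^m` (`map_norm_sq_volume`,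
`map_sectionPoint_prod`). Beta and Gamma integrals show that each family of height densities is
stable under this convolution: exponents move by `m/2`, and in (i) and (ii) the normalising
constants leave `γ` unchanged.

Two cases need more. In (ii) some image points have nonnegative height. They own no cell and cut
none, because almost surely every `w` has negative power with respect to some point of negative
height (`IsPoissonProcess.ae_forall_exists_power_neg`, `laguerre_eq_of_forall_power_neg`). In (iii)
the constant `γ` changes, but a common shift of all heights absorbs this without altering the
diagram (`identDistrib_laguerre_gaussian`).

The rest is measure theory. The law of a Poisson process is determined by its intensity
(`IsPoissonProcess.identDistrib`), and this passes to the diagram because `laguerre` is measurable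
on suitably locally finite configurations (`aemeasurable_laguerre`). Configurations are sets, so the
mapping theorem also needs the map to be almost surely injective on the points; this holds because
the height has no atoms under the image intensity. -/

section

open Set Filter Topology

/-! ### Counting variables and uniqueness of the Poisson law -/

theorem Config.measurable_count {S : Type*} [MeasurableSpace S] {B : Set S}
    (hB : MeasurableSet B) : Measurable fun X : Config S => X.count B := by
  have h : (⊤ : MeasurableSpace ℕ∞).comap (fun X : Config S => X.count B)
      ≤ Config.instMeasurableSpace := le_iSup₂_of_le B hB le_rfl
  exact Measurable.mono (comap_measurable _) h le_rfl

theorem Config.measurable_iff {S Ω : Type*} [MeasurableSpace S] [MeasurableSpace Ω]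
    {f : Ω → Config S} :
    Measurable f ↔ ∀ B, MeasurableSet B → Measurable fun ω => (f ω).count B := by
  refine ⟨fun hf B hB => (Config.measurable_count hB).comp hf, fun h => ?_⟩
  rw [measurable_iff_comap_le]
  simp only [Config.instMeasurableSpace, MeasurableSpace.comap_iSup, MeasurableSpace.comap_comp]
  exact iSup₂_le fun B hB => (h B hB).comap_le

theorem measurable_enat_of_toENNReal {Ω : Type*} [MeasurableSpace Ω] {f : Ω → ℕ∞}
    (hf : Measurable fun ω => (f ω : ℝ≥0∞)) : Measurable f := by
  refine measurable_to_countable' fun k => ?_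
  have : f ⁻¹' {k} = (fun ω => (f ω : ℝ≥0∞)) ⁻¹' {(k : ℝ≥0∞)} := by
    ext ω; simp
  rw [this]
  exact hf (measurableSet_singleton _)

theorem Config.count_mono {S : Type*} (X : Config S) {A B : Set S} (h : A ⊆ B) :
    X.count A ≤ X.count B := encard_le_encard (inter_subset_inter_right _ h)

theorem Config.count_eq_zero {S : Type*} {X : Config S} {B : Set S} :
    X.count B = 0 ↔ ∀ x ∈ X.pts, x ∉ B := by
  simp [Config.count, eq_empty_iff_forall_notMem]

theorem Config.count_iUnion {S ι : Type*} [Fintype ι] (X : Config S) (A : ι → Set S)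
    (hA : Pairwise fun i j => Disjoint (A i) (A j)) :
    X.count (⋃ i, A i) = ∑ i, X.count (A i) := by
  classical
  have key : ∀ s : Finset ι, X.count (⋃ i ∈ s, A i) = ∑ i ∈ s, X.count (A i) := by
    intro s
    induction s using Finset.induction_on with
    | empty => simp [Config.count]
    | insert a s ha ih =>
      rw [Finset.sum_insert ha, ← ih, Finset.set_biUnion_insert, Config.count, inter_union_distrib_left,
        encard_union_eq]
      · rfl
      · refine Disjoint.mono inter_subset_right inter_subset_right ?_
        rw [disjoint_iUnion₂_right]
        exact fun i hi => hA fun h => ha (h ▸ hi)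
  simpa using key Finset.univ

instance isProbabilityMeasure_poissonLaw (a : ℝ≥0∞) : IsProbabilityMeasure (poissonLaw a) := by
  unfold poissonLaw
  split_ifs
  · infer_instance
  · exact Measure.isProbabilityMeasure_map (by fun_prop)

namespace IsPoissonProcess

variable {S Ω : Type*} [MeasurableSpace S] [MeasurableSpace Ω] {μ : Measure S}
  {ξ : Ω → Config S} {P : Measure Ω}

theorem measurable_count (h : IsPoissonProcess μ ξ P) {B : Set S} (hB : MeasurableSet B) :
    Measurable fun ω => (ξ ω).count B := (Config.measurable_count hB).comp h.measurable

theorem isProbabilityMeasure (h : IsPoissonProcess μ ξ P) : IsProbabilityMeasure P := by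
  have := h.law_count ∅ MeasurableSet.empty
  have h2 : IsProbabilityMeasure (P.map fun ω => (ξ ω).count ∅) := this ▸ inferInstance
  exact (Measure.isProbabilityMeasure_map_iff (h.measurable_count MeasurableSet.empty).aemeasurable).1 h2

theorem indep_fintype (h : IsPoissonProcess μ ξ P) {J : Type*} [Fintype J] {B : J → Set S}
    (hB : ∀ i, MeasurableSet (B i)) (hd : Pairwise fun i j => Disjoint (B i) (B j)) :
    iIndepFun (fun i ω => (ξ ω).count (B i)) P := by
  have e := Fintype.equivFin J
  have := h.indep _ (fun i => B (e.symm i)) (fun i => hB _)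
    (fun i j hij => hd (e.symm.injective.ne hij))
  have h2 := this.precomp e.injective
  simpa using h2

theorem map_counts_disjoint (h : IsPoissonProcess μ ξ P) {J : Type*} [Fintype J] {B : J → Set S}
    (hB : ∀ i, MeasurableSet (B i)) (hd : Pairwise fun i j => Disjoint (B i) (B j)) :
    P.map (fun ω i => (ξ ω).count (B i)) = Measure.pi fun i => poissonLaw (μ (B i)) := by
  have := h.isProbabilityMeasure
  rw [(iIndepFun_iff_map_fun_eq_pi_map
    (fun i => (h.measurable_count (hB i)).aemeasurable)).1 (h.indep_fintype hB hd)]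
  simp_rw [h.law_count _ (hB _)]

/-- The finite dimensional distributions of a Poisson process are determined by its intensity. -/
theorem map_counts_eq (h : IsPoissonProcess μ ξ P) {Ω' : Type*} [MeasurableSpace Ω']
    {ξ' : Ω' → Config S} {P' : Measure Ω'} (h' : IsPoissonProcess μ ξ' P')
    {I : Type*} [Fintype I] {B : I → Set S} (hB : ∀ i, MeasurableSet (B i)) :
    P.map (fun ω i => (ξ ω).count (B i)) = P'.map (fun ω i => (ξ' ω).count (B i)) := by
  classical
  -- The atoms of the finite algebra generated by the `B i`. They are disjoint, so their counts are
  -- independent, and the count of each `B i` is a sum of counts of atoms.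
  let A : Finset I → Set S := fun J => {x | ∀ i, i ∈ J ↔ x ∈ B i}
  have hA : ∀ J, MeasurableSet (A J) := fun J => by
    have : A J = ⋂ i, {x | i ∈ J ↔ x ∈ B i} := by ext; simp [A]
    rw [this]
    exact MeasurableSet.iInter fun i => (MeasurableSet.const _).iff (hB i)
  have hd : Pairwise fun J K => Disjoint (A J) (A K) := fun J K hJK => by
    refine Set.disjoint_left.2 fun x hx hx' => ?_
    exact hJK (Finset.ext fun i => (hx i).trans (hx' i).symm)
  let F : (Finset I → ℕ∞) → I → ℕ∞ := fun c i => ∑ J, if i ∈ J then c J else 0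
  have hF : Measurable F := by
    refine measurable_pi_lambda _ fun i => Finset.measurable_sum _ fun J _ => ?_
    split_ifs <;> fun_prop
  have hc : ∀ X : Config S, (fun i => X.count (B i)) = F fun J => X.count (A J) := by
    intro X
    ext1 i
    have hBi : B i = ⋃ J : Finset I, if i ∈ J then A J else ∅ := by
      ext x
      simp only [mem_iUnion]
      constructor
      · intro hx
        refine ⟨Finset.univ.filter fun i => x ∈ B i, ?_⟩
        simp [hx, A]
      · rintro ⟨J, hJ⟩
        split_ifs at hJ with hi
        · exact (hJ i).1 hi
        · exact hJ.elim
    simp only [F]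
    rw [hBi, Config.count_iUnion]
    · refine Finset.sum_congr rfl fun J _ => ?_
      split_ifs
      · rfl
      · simp [Config.count]
    · intro J K hJK
      have := hd hJK
      dsimp only at this ⊢
      split_ifs <;> first | exact this | simp
  rw [show (fun ω i => (ξ ω).count (B i)) = F ∘ fun ω J => (ξ ω).count (A J) from
    funext fun ω => hc (ξ ω), show (fun ω i => (ξ' ω).count (B i)) = F ∘ fun ω J => (ξ' ω).count (A J) from
    funext fun ω => hc (ξ' ω)]
  have e1 := Measure.map_map (μ := P) hF
    (measurable_pi_lambda _ fun J => h.measurable_count (hA J))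
  have e2 := Measure.map_map (μ := P') hF
    (measurable_pi_lambda _ fun J => h'.measurable_count (hA J))
  rw [h.map_counts_disjoint hA hd] at e1
  rw [h'.map_counts_disjoint hA hd] at e2
  exact e1.symm.trans e2

/-- A Poisson process is determined in distribution by its intensity measure. -/
theorem identDistrib (h : IsPoissonProcess μ ξ P) {Ω' : Type*} [MeasurableSpace Ω']
    {ξ' : Ω' → Config S} {P' : Measure Ω'} (h' : IsPoissonProcess μ ξ' P') :
    IdentDistrib ξ ξ' P P' := by
  have := h.isProbabilityMeasure
  have := h'.isProbabilityMeasure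
  refine ⟨h.measurable.aemeasurable, h'.measurable.aemeasurable, ?_⟩
  let Φ : Config S → ({B : Set S // MeasurableSet B} → ℕ∞) := fun X B => X.count B
  have hΦ : Measurable Φ := measurable_pi_lambda _ fun B => Config.measurable_count B.2
  -- The counts generate the `σ`-algebra, so it suffices to compare the laws of the family of all
  -- counts, and these are determined by their finite marginals.
  have hcomap : (Config.instMeasurableSpace : MeasurableSpace (Config S))
      = MeasurableSpace.comap Φ inferInstance := by
    refine le_antisymm (iSup₂_le fun B hB => ?_) hΦ.comap_le
    have : (fun X : Config S => X.count B) = (fun c => c ⟨B, hB⟩) ∘ Φ := rfl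
    rw [this, ← MeasurableSpace.comap_comp]
    exact MeasurableSpace.comap_mono (measurable_pi_apply _).comap_le
  have hproj : (P.map ξ).map Φ = (P'.map ξ').map Φ := by
    have p2 : IsProbabilityMeasure (P'.map ξ') :=
      Measure.isProbabilityMeasure_map h'.measurable.aemeasurable
    have p3 : IsProbabilityMeasure ((P'.map ξ').map Φ) :=
      Measure.isProbabilityMeasure_map hΦ.aemeasurable
    have p4 : ∀ I : Finset {B : Set S // MeasurableSet B}, IsFiniteMeasure
        (((P'.map ξ').map Φ).map I.restrict) := fun I => inferInstance
    refine IsProjectiveLimit.unique (P := fun I => ((P'.map ξ').map Φ).map I.restrict)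
      (fun I => ?_) (fun I => rfl)
    change _ = ((P'.map ξ').map Φ).map I.restrict
    rw [Measure.map_map (by fun_prop) hΦ, Measure.map_map (by fun_prop) h.measurable,
      Measure.map_map (by fun_prop) hΦ, Measure.map_map (by fun_prop) h'.measurable]
    exact h.map_counts_eq h' (B := fun i : I => (i : Set S)) fun i => i.1.2
  ext s hs
  rw [hcomap] at hs
  obtain ⟨t, ht, rfl⟩ := hs
  rw [← Measure.map_apply hΦ ht, hproj, Measure.map_apply hΦ ht]

end IsPoissonProcess

/-! ### The mapping theorem for Poisson processes -/

theorem poissonLaw_two_le (a : ℝ≥0∞) : poissonLaw a {n | 2 ≤ n} ≤ a * a := by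
  by_cases ha : a = ∞
  · simp [ha]
  lift a to ℝ≥0 using ha
  rw [poissonLaw, if_neg ENNReal.coe_ne_top, Measure.map_apply (by fun_prop) (MeasurableSet.of_discrete),
    ENNReal.toNNReal_coe]
  have h1 : ((fun n : ℕ => (n : ℕ∞)) ⁻¹' {n | 2 ≤ n}) = ({0} ∪ {1} : Set ℕ)ᶜ := by
    ext n
    simp only [mem_preimage, mem_ofPred_eq, mem_compl_iff, mem_union, mem_singleton_iff]
    rw [Nat.ofNat_le_cast]
    omega
  have h2 : (poissonMeasure a).real ({0} ∪ {1} : Set ℕ)ᶜ ≤ (a : ℝ) * a := by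
    rw [probReal_compl_eq_one_sub (by measurability), measureReal_union (by simp) (by simp),
      poissonMeasure_real_singleton, poissonMeasure_real_singleton]
    -- The probability in question is `1 - (1 + a) * exp (-a)`, at most `1 - (1 + a) * (1 - a) =
    -- a²`.
    have := Real.add_one_le_exp (-(a : ℝ))
    have h0 : (0 : ℝ) ≤ a := a.2
    simp
    nlinarith
  rw [h1, ← ENNReal.ofReal_toReal (measure_ne_top _ _), ← measureReal_def]
  refine (ENNReal.ofReal_le_ofReal h2).trans ?_
  rw [ENNReal.ofReal_mul a.coe_nonneg]
  simp

theorem poissonLaw_zero_singleton {a : ℝ≥0∞} (ha : a ≠ ∞) :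
    poissonLaw a {0} = ENNReal.ofReal (Real.exp (-a.toReal)) := by
  rw [poissonLaw, if_neg ha, Measure.map_apply (by fun_prop) (MeasurableSet.of_discrete)]
  have h1 : ((fun n : ℕ => (n : ℕ∞)) ⁻¹' {0}) = ({0} : Set ℕ) := by ext n; simp
  rw [h1, poissonMeasure_singleton]
  simp [ENNReal.toReal]

/-- The image of a configuration under `f`, restricted to `U`. -/
def Config.mapOn {S S' : Type*} (f : S → S') (U : Set S') (X : Config S) : Config S' where
  pts := f '' X.pts ∩ U

theorem Config.count_mapOn {S S' : Type*} {f : S → S'} {U : Set S'} {X : Config S}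
    (hf : InjOn f (X.pts ∩ f ⁻¹' U)) (B : Set S') :
    (X.mapOn f U).count B = X.count (f ⁻¹' (B ∩ U)) := by
  have : f '' X.pts ∩ U ∩ B = f '' (X.pts ∩ f ⁻¹' (B ∩ U)) := by
    rw [image_inter_preimage, inter_assoc, inter_comm U B]
  rw [Config.count, Config.count, Config.mapOn, this, InjOn.encard_image]
  exact hf.mono (by gcongr; exact inter_subset_right)

theorem Int.floor_mul_ne_of_dist {s t : ℝ} (h : s ≠ t) :
    ∀ᶠ k : ℕ in atTop, ⌊(k : ℝ) * s⌋ ≠ ⌊(k : ℝ) * t⌋ := by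
  have hpos : 0 < |s - t| := abs_pos.2 (sub_ne_zero.2 h)
  have : Tendsto (fun k : ℕ => (k : ℝ) * |s - t|) atTop atTop :=
    tendsto_natCast_atTop_atTop.atTop_mul_const hpos
  filter_upwards [this.eventually_ge_atTop 1] with k hk hne
  have := Int.abs_sub_lt_one_of_floor_eq_floor hne
  rw [← mul_sub, abs_mul, Nat.abs_cast] at this
  linarith

namespace IsPoissonProcess

variable {S Ω : Type*} [MeasurableSpace S] [MeasurableSpace Ω] {μ : Measure S}
  {ξ : Ω → Config S} {P : Measure Ω}

theorem ae_count_lt_top (h : IsPoissonProcess μ ξ P) {B : Set S} (hB : MeasurableSet B)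
    (hμ : μ B ≠ ∞) : ∀ᵐ ω ∂P, (ξ ω).count B < ⊤ := by
  have h1 : poissonLaw (μ B) {⊤} = 0 := by
    rw [poissonLaw, if_neg hμ, Measure.map_apply (by fun_prop) (MeasurableSet.of_discrete)]
    convert measure_empty (μ := poissonMeasure (μ B).toNNReal)
    ext n; simp
  rw [← h.law_count B hB, Measure.map_apply (h.measurable_count hB) (MeasurableSet.of_discrete)] at h1
  rw [ae_iff]
  convert h1 using 2
  ext ω; simp

/-- Almost surely, the points of a Poisson process are separated by any function all of whose level
sets are null sets. -/
theorem ae_injOn_of_finite (h : IsPoissonProcess μ ξ P) {W : Set S} (hW : MeasurableSet W)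
    (hfin : μ W ≠ ∞) {g : S → ℝ} (hg : Measurable g) (hnull : ∀ c, μ (W ∩ g ⁻¹' {c}) = 0) :
    ∀ᵐ ω ∂P, InjOn g ((ξ ω).pts ∩ W) := by
  set ν := μ.restrict W with hν
  have : IsFiniteMeasure ν := ⟨by simpa [hν] using hfin.lt_top⟩
  -- Cut the values of `g` into intervals of length `1/k`. Two points with equal values share an
  -- interval, which has probability at most the sum of the squared masses, the product measure of
  -- `D k`; this tends to the mass of `{g p.1 = g p.2}`, which is zero.
  let D : ℕ → Set (S × S) := fun k => {p | ⌊(k : ℝ) * g p.1⌋ = ⌊(k : ℝ) * g p.2⌋}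
  let A : ℕ → ℤ → Set S := fun k i => {x | ⌊(k : ℝ) * g x⌋ = i}
  have hA : ∀ k i, MeasurableSet (A k i) := fun k i =>
    measurableSet_eq_fun (Int.measurable_floor.comp (hg.const_mul _)) measurable_const
  have hD : ∀ k, MeasurableSet (D k) := fun k =>
    measurableSet_eq_fun (Int.measurable_floor.comp ((hg.comp measurable_fst).const_mul _))
      (Int.measurable_floor.comp ((hg.comp measurable_snd).const_mul _))
  have hsum : ∀ k, ∑' i, ν (A k i) * ν (A k i) = (ν.prod ν) (D k) := by
    intro k
    have hDA : D k = ⋃ i, A k i ×ˢ A k i := by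
      ext p
      simp only [D, A, mem_ofPred_eq, mem_iUnion, mem_prod]
      exact ⟨fun hp => ⟨_, rfl, hp.symm⟩, fun ⟨i, h1, h2⟩ => h1.trans h2.symm⟩
    rw [hDA, measure_iUnion _ fun i => (hA k i).prod (hA k i)]
    · simp [Measure.prod_prod]
    · intro i j hij
      refine Set.disjoint_left.2 fun p hp hp' => hij ?_
      exact hp.1.symm.trans hp'.1
  have hdiag : (ν.prod ν) {p : S × S | g p.1 = g p.2} = 0 := by
    have hm : MeasurableSet {p : S × S | g p.1 = g p.2} :=
      measurableSet_eq_fun (hg.comp measurable_fst) (hg.comp measurable_snd)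
    rw [Measure.measure_prod_null hm]
    refine Eventually.of_forall fun x => ?_
    change ν (Prod.mk x ⁻¹' {p : S × S | g p.1 = g p.2}) = 0
    have : Prod.mk x ⁻¹' {p : S × S | g p.1 = g p.2} = g ⁻¹' {g x} := by
      ext y; simp [eq_comm]
    rw [this, hν, Measure.restrict_apply (hg (measurableSet_singleton _)), inter_comm, hnull]
  have hlim : Tendsto (fun k => (ν.prod ν) (D k)) atTop (𝓝 0) := by
    rw [← hdiag]
    refine tendsto_measure_of_tendsto_indicator_of_isFiniteMeasure atTop _ (fun k => hD k) ?_
    intro p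
    by_cases hp : g p.1 = g p.2
    · exact Eventually.of_forall fun k => by simp [D, hp]
    · filter_upwards [Int.floor_mul_ne_of_dist hp] with k hk
      simp [D, hp, hk]
  rw [ae_iff]
  refine le_antisymm (ge_of_tendsto' hlim fun k => ?_) zero_le
  rw [← hsum]
  calc P {ω | ¬ InjOn g ((ξ ω).pts ∩ W)}
      ≤ P (⋃ i, {ω | 2 ≤ (ξ ω).count (W ∩ A k i)}) := by
        refine measure_mono fun ω hω => ?_
        simp only [mem_ofPred_eq, InjOn, not_forall] at hω
        obtain ⟨x, hx, y, hy, hxy, hne⟩ := hω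
        refine mem_iUnion.2 ⟨⌊(k : ℝ) * g x⌋, ?_⟩
        have : 1 < (ξ ω).count (W ∩ A k ⌊(k : ℝ) * g x⌋) := by
          rw [Config.count, one_lt_encard_iff]
          exact ⟨x, y, ⟨hx.1, hx.2, rfl⟩, ⟨hy.1, hy.2, by simp [A, hxy]⟩, hne⟩
        exact Order.add_one_le_of_lt this
    _ ≤ ∑' i, P {ω | 2 ≤ (ξ ω).count (W ∩ A k i)} := measure_iUnion_le _
    _ ≤ ∑' i, ν (A k i) * ν (A k i) := by
        refine ENNReal.tsum_le_tsum fun i => ?_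
        have hm := hW.inter (hA k i)
        have : {ω | 2 ≤ (ξ ω).count (W ∩ A k i)}
          = (fun ω => (ξ ω).count (W ∩ A k i)) ⁻¹' {n | 2 ≤ n} := rfl
        rw [this, ← Measure.map_apply (h.measurable_count hm) (MeasurableSet.of_discrete),
          h.law_count _ hm, hν, Measure.restrict_apply (hA k i), inter_comm]
        exact poissonLaw_two_le _

/-- The mapping theorem for Poisson processes, combined with a restriction to `U`. -/
theorem mapOn (h : IsPoissonProcess μ ξ P) {S' : Type*} [MeasurableSpace S'] {f : S → S'}
    (hf : Measurable f) {U : Set S'} (hU : MeasurableSet U) [SigmaFinite ((μ.map f).restrict U)]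
    {g : S' → ℝ} (hg : Measurable g) (hnull : ∀ c, (μ.map f).restrict U (g ⁻¹' {c}) = 0) :
    ∃ ξ' : Ω → Config S', IsPoissonProcess ((μ.map f).restrict U) ξ' P ∧
      ∀ᵐ ω ∂P, ξ' ω = (ξ ω).mapOn f U := by
  classical
  have hinj : ∀ᵐ ω ∂P, InjOn f ((ξ ω).pts ∩ f ⁻¹' U) := by
    let V := spanningSets ((μ.map f).restrict U)
    have hV : ∀ n, MeasurableSet (V n) := measurableSet_spanningSets _
    have : ∀ n, ∀ᵐ ω ∂P, InjOn (g ∘ f) ((ξ ω).pts ∩ f ⁻¹' (V n ∩ U)) := fun n => by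
      refine h.ae_injOn_of_finite (hf ((hV n).inter hU)) ?_ (hg.comp hf) fun c => ?_
      · rw [← Measure.map_apply hf ((hV n).inter hU), ← Measure.restrict_apply (hV n)]
        exact (measure_spanningSets_lt_top _ n).ne
      · refine measure_mono_null (t := f ⁻¹' (g ⁻¹' {c} ∩ U)) ?_ ?_
        · exact fun x hx => ⟨hx.2, hx.1.2⟩
        · rw [← Measure.map_apply hf ((hg (measurableSet_singleton c)).inter hU),
            ← Measure.restrict_apply (hg (measurableSet_singleton c))]
          exact hnull c
    filter_upwards [ae_all_iff.2 this] with ω hω x hx y hy hxy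
    obtain ⟨m, hm⟩ := mem_iUnion.1 ((iUnion_spanningSets ((μ.map f).restrict U)).ge
      (mem_univ (f x)))
    obtain ⟨n, hn⟩ := mem_iUnion.1 ((iUnion_spanningSets ((μ.map f).restrict U)).ge
      (mem_univ (f y)))
    have hmono := monotone_spanningSets ((μ.map f).restrict U)
    exact hω (max m n) ⟨hx.1, hmono (le_max_left _ _) hm, hx.2⟩
      ⟨hy.1, hmono (le_max_right _ _) hn, hy.2⟩ (congrArg g hxy)
  -- The failure of injectivity need not be a measurable event. The new process is emptied on a
  -- measurable null set containing it, which makes all its counts measurable.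
  set N := toMeasurable P {ω | ¬ InjOn f ((ξ ω).pts ∩ f ⁻¹' U)} with hN
  have hNm : MeasurableSet N := measurableSet_toMeasurable _ _
  have hNae : ∀ᵐ ω ∂P, ω ∉ N := by
    rw [ae_iff]
    simpa [hN, measure_toMeasurable] using ae_iff.1 hinj
  have hNinj : ∀ ω, ω ∉ N → InjOn f ((ξ ω).pts ∩ f ⁻¹' U) := fun ω hω => by
    by_contra hc
    exact hω (subset_toMeasurable P _ hc)
  have hmeas : ∀ B, MeasurableSet B → MeasurableSet (f ⁻¹' (B ∩ U)) := fun B hB => hf (hB.inter hU)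
  let ξ' : Ω → Config S' := fun ω => if ω ∈ N then ⟨∅⟩ else (ξ ω).mapOn f U
  have hcount : ∀ B, ∀ᵐ ω ∂P, (ξ' ω).count B = (ξ ω).count (f ⁻¹' (B ∩ U)) := fun B => by
    filter_upwards [hNae] with ω hω
    simp only [ξ', if_neg hω]
    exact Config.count_mapOn (hNinj ω hω) B
  refine ⟨ξ', ⟨?_, fun B hB => ?_, fun n B hB hd => ?_⟩, ?_⟩
  · rw [Config.measurable_iff]
    intro B hB
    have : (fun ω => (ξ' ω).count B)
        = fun ω => if ω ∈ N then 0 else (ξ ω).count (f ⁻¹' (B ∩ U)) := by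
      ext1 ω
      by_cases hω : ω ∈ N
      · simp [ξ', hω, Config.count]
      · simp only [ξ', if_neg hω]
        exact Config.count_mapOn (hNinj ω hω) B
    rw [this]
    exact Measurable.ite hNm measurable_const (h.measurable_count (hmeas B hB))
  · rw [Measure.map_congr (hcount B), h.law_count _ (hmeas B hB), Measure.restrict_apply hB,
      Measure.map_apply hf (hB.inter hU)]
  · refine (h.indep n (fun i => f ⁻¹' (B i ∩ U)) (fun i => hmeas _ (hB i)) fun i j hij => ?_).congr
      fun i => Filter.EventuallyEq.symm (hcount (B i))
    exact Disjoint.preimage _ ((hd hij).mono inter_subset_left inter_subset_left)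
  · filter_upwards [hNae] with ω hω
    simp [ξ', hω]

end IsPoissonProcess

/-! ### Measurability of counts depending on a parameter -/

section Counting

variable {S : Type*} [MeasurableSpace S]

/-- The counting measure of a configuration. -/
noncomputable def Config.countingMeasure (X : Config S) : Measure S :=
  Measure.sum fun x : X.pts => Measure.dirac (x : S)

theorem Config.countingMeasure_apply (X : Config S) {B : Set S} (hB : MeasurableSet B) :
    X.countingMeasure B = (X.count B : ℝ≥0∞) := by
  rw [Config.countingMeasure, Measure.sum_apply _ hB]
  simp_rw [Measure.dirac_apply' _ hB]
  rw [tsum_subtype X.pts (B.indicator 1), Set.indicator_indicator]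
  have : (X.pts ∩ B).indicator (1 : S → ℝ≥0∞) = (X.pts ∩ B).indicator fun _ => 1 := rfl
  rw [this, ← tsum_subtype, ENNReal.tsum_set_one]
  rfl

variable {α : Type*} [MeasurableSpace α]

/-- The kernel of counting measures of a measurable family of configurations. -/
noncomputable def countingKernel (F : α → Config S) (hF : Measurable F) : Kernel α S where
  toFun a := (F a).countingMeasure
  measurable' := by
    refine Measure.measurable_of_measurable_coe _ fun B hB => ?_
    simp_rw [Config.countingMeasure_apply _ hB]
    exact (Measurable.of_discrete (f := fun n : ℕ∞ => (n : ℝ≥0∞))).comp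
      ((Config.measurable_count hB).comp hF)

/-- The counts in `V n` are finite but not uniformly bounded in the parameter. Splitting further by
the value `k` of the count gives kernels of mass at most `k`. -/
theorem isSFiniteKernel_countingKernel {F : α → Config S} (hF : Measurable F) {V : ℕ → Set S}
    (hV : ∀ n, MeasurableSet (V n)) (hd : Pairwise fun i j => Disjoint (V i) (V j))
    (hU : ⋃ n, V n = univ) (hfin : ∀ a n, (F a).count (V n) < ⊤) :
    IsSFiniteKernel (countingKernel F hF) := by
  classical
  have hm : ∀ p : ℕ × ℕ, MeasurableSet {a | (F a).count (V p.1) = (p.2 : ℕ∞)} := fun p =>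
    ((Config.measurable_count (hV p.1)).comp hF) (measurableSet_singleton _)
  let κ : ℕ × ℕ → Kernel α S := fun p =>
    Kernel.piecewise (hm p) ((countingKernel F hF).restrict (hV p.1)) 0
  have hκ : ∀ p, IsFiniteKernel (κ p) := fun p => by
    refine ⟨⟨(p.2 : ℝ≥0∞), ENNReal.natCast_lt_top _, fun a => ?_⟩⟩
    simp only [κ, Kernel.piecewise_apply, mem_ofPred_eq]
    split_ifs with h
    · rw [Kernel.restrict_apply, Measure.restrict_apply_univ]
      change (F a).countingMeasure _ ≤ _
      rw [Config.countingMeasure_apply _ (hV _), h]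
      simp
    · simp
  have : countingKernel F hF = Kernel.sum κ := by
    ext a B hB
    rw [Kernel.sum_apply' _ _ hB, ENNReal.tsum_prod']
    have h1 : ∀ n, ∑' k, κ (n, k) a B = (F a).countingMeasure (B ∩ V n) := fun n => by
      obtain ⟨k, hk⟩ := ENat.ne_top_iff_exists.1 (hfin a n).ne
      rw [tsum_eq_single k]
      · simp only [κ, Kernel.piecewise_apply, mem_ofPred_eq]
        rw [if_pos hk.symm, Kernel.restrict_apply, Measure.restrict_apply hB]
        rfl
      · intro j hj
        simp only [κ, Kernel.piecewise_apply, mem_ofPred_eq]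
        rw [if_neg]
        · simp
        · rw [← hk]; exact_mod_cast hj.symm
    simp_rw [h1]
    rw [← measure_iUnion (fun i j hij => (hd hij).mono inter_subset_right inter_subset_right)
      fun n => hB.inter (hV n), ← inter_iUnion, hU, inter_univ]
    rfl
  rw [this]
  infer_instance

/-- The number of points in a set which depends measurably on a parameter is measurable. -/
theorem measurable_count_section {F : α → Config S} (hF : Measurable F) {V : ℕ → Set S}
    (hV : ∀ n, MeasurableSet (V n)) (hd : Pairwise fun i j => Disjoint (V i) (V j))
    (hU : ⋃ n, V n = univ) (hfin : ∀ a n, (F a).count (V n) < ⊤) {t : Set (α × S)}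
    (ht : MeasurableSet t) : Measurable fun a => (F a).count {x | (a, x) ∈ t} := by
  have := isSFiniteKernel_countingKernel hF hV hd hU hfin
  refine measurable_enat_of_toENNReal ?_
  convert Kernel.measurable_kernel_prodMk_left (κ := countingKernel F hF) ht using 2 with a
  exact (Config.countingMeasure_apply _ (measurable_prodMk_left ht)).symm

/-- The number of distinct values in a measurable set which a measurable function takes on a
locally finite configuration is measurable. -/
theorem measurable_encard_image {F : α → Config S} (hF : Measurable F) {r : S → ℝ}
    (hr : Measurable r) (hinj : Function.Injective r)
    (hfin : ∀ a, ∀ n : ℕ, (F a).count {x | r x ≤ n} < ⊤)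
    {Z : Type*} [MeasurableSpace Z] (hZ : MeasurableSet {p : Z × Z | p.1 = p.2})
    {Φ : α → S → Z} (hΦ : Measurable fun p : α × S => Φ p.1 p.2) {N : Set Z}
    (hN : MeasurableSet N) :
    Measurable fun a => {z | z ∈ N ∧ ∃ x ∈ (F a).pts, z = Φ a x}.encard := by
  let V : ℕ → Set S := disjointed fun n : ℕ => {x | r x ≤ n}
  have hV : ∀ n, MeasurableSet (V n) := fun n =>
    MeasurableSet.disjointed (fun n => measurableSet_le hr measurable_const) n
  have hd : Pairwise fun i j => Disjoint (V i) (V j) := disjoint_disjointed _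
  have hU : ⋃ n, V n = univ := by
    rw [iUnion_disjointed, eq_univ_iff_forall]
    exact fun x => mem_iUnion.2 (exists_nat_ge (r x))
  have hfV : ∀ a n, (F a).count (V n) < ⊤ := fun a n =>
    ((F a).count_mono (disjointed_subset _ n)).trans_lt (hfin a n)
  -- To count values rather than points, keep from each fibre of `Φ a` only the point of least rank,
  -- which exists since sublevel sets of `r` contain finitely many points. A point is kept when no
  -- point of smaller rank has the same value.
  let s : Set ((α × S) × S) := {q | r q.2 < r q.1.2 ∧ Φ q.1.1 q.2 = Φ q.1.1 q.1.2}
  have hs : MeasurableSet s := by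
    refine MeasurableSet.inter ?_ ?_
    · exact measurableSet_lt (hr.comp measurable_snd) (hr.comp (measurable_snd.comp measurable_fst))
    · have : Measurable fun q : (α × S) × S => (Φ q.1.1 q.2, Φ q.1.1 q.1.2) :=
        (hΦ.comp ((measurable_fst.comp measurable_fst).prodMk measurable_snd)).prodMk
          (hΦ.comp measurable_fst)
      exact this hZ
  have hsm := measurable_count_section (hF.comp measurable_fst) hV hd hU (fun a n => hfV a.1 n) hs
  let t : Set (α × S) := {p | Φ p.1 p.2 ∈ N ∧ (F p.1).count {y | (p, y) ∈ s} = 0}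
  have ht : MeasurableSet t := (hΦ hN).inter (hsm (measurableSet_singleton 0))
  convert measurable_count_section hF hV hd hU hfV ht using 2 with a
  have himg : {z | z ∈ N ∧ ∃ x ∈ (F a).pts, z = Φ a x}
      = Φ a '' ((F a).pts ∩ {x | (a, x) ∈ t}) := by
    ext z
    constructor
    · rintro ⟨hz, x, hx, rfl⟩
      obtain ⟨n, hn⟩ := exists_nat_ge (r x)
      have hf : ((F a).pts ∩ {y | r y ≤ n}).Finite := encard_lt_top_iff.1 (hfin a n)
      have hf2 : ((F a).pts ∩ {y | r y ≤ n} ∩ {y | Φ a y = Φ a x}).Finite :=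
        hf.subset inter_subset_left
      obtain ⟨m, hm, hmin⟩ := exists_min_image _ r hf2 ⟨x, ⟨hx, hn⟩, rfl⟩
      refine ⟨m, ⟨hm.1.1, ?_, ?_⟩, hm.2⟩
      · change Φ a m ∈ N
        rw [hm.2]; exact hz
      · rw [Config.count_eq_zero]
        rintro y hy ⟨hlt, heq⟩
        exact absurd (hmin y ⟨⟨hy, hlt.le.trans hm.1.2⟩, heq.trans hm.2⟩) (not_le.2 hlt)
    · rintro ⟨x, ⟨hx, hx1, -⟩, rfl⟩
      exact ⟨hx1, x, hx, rfl⟩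
  rw [himg, InjOn.encard_image]
  · rfl
  · rintro x ⟨hx, -, hx1⟩ y ⟨hy, -, hy1⟩ hxy
    rw [Config.count_eq_zero] at hx1 hy1
    by_contra hne
    rcases lt_or_gt_of_ne (hinj.ne hne) with h | h
    · exact hy1 x hx ⟨h, hxy⟩
    · exact hx1 y hy ⟨h, hxy.symm⟩

/-- A `σ`-finite measure on a standard Borel space has finite mass on the sublevel sets of an
injective function. -/
theorem exists_injective_rank [StandardBorelSpace S] (ν : Measure S) [SigmaFinite ν] :
    ∃ r : S → ℝ, Measurable r ∧ Function.Injective r ∧ ∀ n : ℕ, ν {x | r x ≤ n} ≠ ∞ := by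
  let e := embeddingReal S
  have he : MeasurableEmbedding e := measurableEmbedding_embeddingReal S
  let i : S → ℕ := spanningSetsIndex ν
  have hi : Measurable i := measurableSet_spanningSetsIndex ν
  -- The sigmoid takes values in `(0, 1)`, so the sum determines both the index and the embedded
  -- point, and `r x ≤ n` forces `x` into the `n`-th spanning set.
  refine ⟨fun x => i x + Real.sigmoid (e x), ?_, ?_, fun n => ?_⟩
  · exact (Measurable.of_discrete (f := fun n : ℕ => (n : ℝ)) |>.comp hi).add
      (continuous_sigmoid.measurable.comp he.measurable)
  · intro x y hxy
    dsimp only at hxy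
    have h1 := Real.sigmoid_pos (e x)
    have h2 := Real.sigmoid_lt_one (e x)
    have h3 := Real.sigmoid_pos (e y)
    have h4 := Real.sigmoid_lt_one (e y)
    have h5 : i x < i y + 1 := by
      have : (i x : ℝ) < i y + 1 := by linarith
      exact_mod_cast this
    have h6 : i y < i x + 1 := by
      have : (i y : ℝ) < i x + 1 := by linarith
      exact_mod_cast this
    have h7 : i x = i y := by omega
    rw [h7] at hxy
    exact he.injective (Real.sigmoid_injective (add_left_cancel hxy))
  · refine (lt_of_le_of_lt (measure_mono fun x hx => ?_) (measure_spanningSets_lt_top ν n)).ne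
    have h1 := Real.sigmoid_pos (e x)
    have h2 : i x ≤ n := by
      have : (i x : ℝ) ≤ n := by
        have hx' : (i x : ℝ) + Real.sigmoid (e x) ≤ n := hx
        linarith
      exact_mod_cast this
    exact monotone_spanningSets ν h2 (mem_spanningSetsIndex ν x)

end Counting

/-! ### The measurable space of closed sets -/

section ClosedSets

variable {E : Type*} [TopologicalSpace E]

theorem measurableSet_hits {G : Set E} (hG : IsOpen G) :
    MeasurableSet {F : Closeds E | ((F : Set E) ∩ G).Nonempty} :=
  MeasurableSpace.measurableSet_generateFrom ⟨G, hG, rfl⟩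

theorem measurableSet_closeds_nonempty : MeasurableSet {F : Closeds E | (F : Set E).Nonempty} := by
  simpa using measurableSet_hits (E := E) isOpen_univ

/-- A closed set is its own closure, so it is determined by which members of a countable base it
hits. -/
theorem measurableSet_closeds_eq [SecondCountableTopology E] :
    MeasurableSet {p : Closeds E × Closeds E | p.1 = p.2} := by
  have : {p : Closeds E × Closeds E | p.1 = p.2} = ⋂ G ∈ countableBasis E,
      {p | ((p.1 : Set E) ∩ G).Nonempty ↔ ((p.2 : Set E) ∩ G).Nonempty} := by
    ext p
    simp only [mem_ofPred_eq, mem_iInter]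
    refine ⟨fun h G _ => by rw [h], fun h => ?_⟩
    have hb := isBasis_countableBasis E
    refine SetLike.coe_injective ?_
    rw [← p.1.isClosed.closure_eq, ← p.2.isClosed.closure_eq]
    ext x
    rw [hb.mem_closure_iff, hb.mem_closure_iff]
    refine forall_congr' fun G => forall_congr' fun hG => forall_congr' fun _ => ?_
    rw [inter_comm, h G hG, inter_comm]
  rw [this]
  refine MeasurableSet.biInter (countable_countableBasis E) fun G hG => ?_
  have hGo := isOpen_of_mem_countableBasis hG
  exact (measurable_fst (measurableSet_hits hGo)).iff (measurable_snd (measurableSet_hits hGo))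

end ClosedSets

/-! ### Measurability of the Laguerre diagram -/

section Laguerre

variable {d : ℕ}

theorem continuous_power_left (x : Euc d × ℝ) : Continuous fun w => power w x := by
  unfold power; fun_prop

theorem continuous_power_right (w : Euc d) : Continuous fun x => power w x := by
  unfold power; fun_prop

/-- The quadratic terms in `w` cancel, so the difference of powers is affine in `w` with gradient `2
* (y.1 - x.1)`. The Lipschitz bound is uniform over all `y` of bounded position, whatever their
heights. -/
theorem power_sub_power_le {w w' : Euc d} {x y : Euc d × ℝ} {R : ℝ} (hy : ‖y.1‖ ≤ R) :
    power w' x - power w' y ≤ power w x - power w y + 2 * (‖x.1‖ + R) * ‖w' - w‖ := by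
  have e : ∀ v u : Euc d, ‖v - u‖ ^ 2 = ‖v‖ ^ 2 - 2 * inner ℝ v u + ‖u‖ ^ 2 := fun v u =>
    norm_sub_sq_real v u
  have key : power w' x - power w' y = power w x - power w y + 2 * inner ℝ (w' - w) (y.1 - x.1) := by
    simp only [power, e, inner_sub_left, inner_sub_right]
    ring
  have h1 := real_inner_le_norm (w' - w) (y.1 - x.1)
  have h2 : ‖y.1 - x.1‖ ≤ ‖x.1‖ + R := (norm_sub_le _ _).trans (by linarith)
  have h3 := mul_le_mul_of_nonneg_left h2 (norm_nonneg (w' - w))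
  rw [key]
  linarith

/-- Whether a cell hits a compact set can be decided on a countable dense subset. -/
theorem laguerreCell_inter_nonempty_iff {K : Set (Euc d)} (hK : IsCompact K)
    {D : ℕ → K} (hD : DenseRange D) (x : Euc d × ℝ) (X : Config (Euc d × ℝ)) :
    ((laguerreCell x X : Set (Euc d)) ∩ K).Nonempty ↔
      ∀ n : ℕ, ∃ k : ℕ, ∀ y ∈ X.pts, ‖y.1‖ ≤ n →
        power (D k : Euc d) x ≤ power (D k : Euc d) y + 1 / ((n : ℝ) + 1) := by
  constructor
  · rintro ⟨w, hw, hwK⟩ n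
    -- A Lipschitz constant valid for all `y` with `‖y.1‖ ≤ n`; the summand `1` keeps it positive.
    set C := 2 * (‖x.1‖ + n) + 1 with hC
    have hCpos : 0 < C := by positivity
    obtain ⟨k, hk⟩ := hD.exists_dist_lt ⟨w, hwK⟩ (ε := 1 / ((n : ℝ) + 1) / C) (by positivity)
    refine ⟨k, fun y hy hyn => ?_⟩
    have h1 := power_sub_power_le (w := w) (w' := D k) (x := x) hyn
    have h2 : power w x ≤ power w y := hw y hy
    have h3 : ‖(D k : Euc d) - w‖ < 1 / ((n : ℝ) + 1) / C := by
      rw [Subtype.dist_eq, dist_comm, dist_eq_norm] at hk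
      exact hk
    rw [lt_div_iff₀ hCpos] at h3
    have h4 := norm_nonneg ((D k : Euc d) - w)
    nlinarith
  · intro h
    choose k hk using h
    -- Along a convergent subsequence of approximate solutions the slack vanishes and each fixed `y`
    -- is eventually among the constraints, so the limit lies in the cell.
    obtain ⟨w, hwK, φ, hφ, hlim⟩ := hK.tendsto_subseq fun n => (D (k n)).2
    refine ⟨w, fun y hy => ?_, hwK⟩
    have l1 := ((continuous_power_left x).tendsto w).comp hlim
    have l2 := ((continuous_power_left y).tendsto w).comp hlim
    have l3 : Tendsto (fun n => 1 / ((φ n : ℝ) + 1)) atTop (𝓝 0) :=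
      tendsto_one_div_add_atTop_nhds_zero_nat.comp hφ.tendsto_atTop
    have l4 := l2.add l3
    rw [add_zero] at l4
    refine le_of_tendsto_of_tendsto l1 l4 ?_
    obtain ⟨m, hm⟩ := exists_nat_ge ‖y.1‖
    filter_upwards [eventually_ge_atTop m] with n hn
    refine hk (φ n) y hy (hm.trans ?_)
    exact_mod_cast hn.trans (hφ.id_le n)

/-- A violation `g y < f p.2` is witnessed by a rational in between, which turns the quantifier over
the points into countably many conditions on counts. -/
theorem measurableSet_forall_le {S : Type*} [MeasurableSpace S] {f g : S → ℝ} (hf : Measurable f)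
    (hg : Measurable g) {B : Set S} (hB : MeasurableSet B) :
    MeasurableSet {p : Config S × S | ∀ y ∈ p.1.pts, y ∈ B → f p.2 ≤ g y} := by
  have : {p : Config S × S | ∀ y ∈ p.1.pts, y ∈ B → f p.2 ≤ g y} = ⋂ q : ℚ,
      {p | p.1.count (B ∩ {y | g y < q}) = 0 ∨ f p.2 ≤ q} := by
    ext p
    simp only [mem_ofPred_eq, mem_iInter, Config.count_eq_zero]
    constructor
    · intro h q
      by_cases hq : f p.2 ≤ q
      · exact Or.inr hq
      · refine Or.inl ?_
        rintro y hy ⟨hyB, hyq⟩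
        exact hq ((h y hy hyB).trans (le_of_lt hyq))
    · intro h y hy hyB
      by_contra hlt
      obtain ⟨q, hq1, hq2⟩ := exists_rat_btwn (not_le.1 hlt)
      rcases h q with h | h
      · exact h y hy ⟨hyB, hq1⟩
      · exact absurd hq2 (not_lt.2 h)
  rw [this]
  refine MeasurableSet.iInter fun q => MeasurableSet.union ?_ ?_
  · exact ((Config.measurable_count (hB.inter (measurableSet_lt hg measurable_const))).comp
      measurable_fst) (measurableSet_singleton 0)
  · exact measurableSet_le (hf.comp measurable_snd) measurable_const

/-- An open set of `ℝ^d` is a countable union of compact sets, and hitting a compact set is a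
countable condition by `laguerreCell_inter_nonempty_iff`. -/
theorem measurable_laguerreCell :
    Measurable fun p : Config (Euc d × ℝ) × (Euc d × ℝ) => laguerreCell p.2 p.1 := by
  refine measurable_generateFrom ?_
  rintro _ ⟨G, hG, rfl⟩
  have : SigmaCompactSpace G := by
    have := hG.locallyCompactSpace
    infer_instance
  let K : ℕ → Set (Euc d) := fun n => (↑) '' compactCovering G n
  have hK : ∀ n, IsCompact (K n) := fun n =>
    (isCompact_compactCovering G n).image continuous_subtype_val
  have hKG : G = ⋃ n, K n := by
    rw [← image_iUnion, iUnion_compactCovering, image_univ, Subtype.range_coe]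
  have : (fun p : Config (Euc d × ℝ) × (Euc d × ℝ) => laguerreCell p.2 p.1) ⁻¹'
      {F | ((F : Set (Euc d)) ∩ G).Nonempty}
      = ⋃ n, {p | ((laguerreCell p.2 p.1 : Set (Euc d)) ∩ K n).Nonempty} := by
    ext p
    simp only [mem_preimage, mem_ofPred_eq, mem_iUnion]
    rw [← nonempty_iUnion, ← inter_iUnion, ← hKG]
  rw [this]
  refine MeasurableSet.iUnion fun n => ?_
  rcases (K n).eq_empty_or_nonempty with h0 | hne
  · simp [h0]
  have : Nonempty (K n) := hne.to_subtype
  have : {p : Config (Euc d × ℝ) × (Euc d × ℝ) |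
      ((laguerreCell p.2 p.1 : Set (Euc d)) ∩ K n).Nonempty} = ⋂ m : ℕ, ⋃ k : ℕ,
      {p | ∀ y ∈ p.1.pts, y ∈ {y : Euc d × ℝ | ‖y.1‖ ≤ m} →
        power (denseSeq (K n) k : Euc d) p.2
          ≤ power (denseSeq (K n) k : Euc d) y + 1 / ((m : ℝ) + 1)} := by
    ext p
    simp only [mem_ofPred_eq, mem_iInter, mem_iUnion]
    exact laguerreCell_inter_nonempty_iff (hK n) (denseRange_denseSeq _) p.2 p.1
  rw [this]
  refine MeasurableSet.iInter fun m => MeasurableSet.iUnion fun k => ?_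
  exact measurableSet_forall_le (continuous_power_right _).measurable
    ((continuous_power_right _).measurable.add_const _)
    (measurableSet_le (by fun_prop) measurable_const)

/-- The Laguerre diagram is a measurable function of locally finite configurations. -/
theorem measurable_laguerre_comp {α : Type*} [MeasurableSpace α] {F : α → Config (Euc d × ℝ)}
    (hF : Measurable F) {r : Euc d × ℝ → ℝ} (hr : Measurable r) (hinj : Function.Injective r)
    (hfin : ∀ a, ∀ n : ℕ, (F a).count {x | r x ≤ n} < ⊤) :
    Measurable fun a => laguerre (F a) := by
  rw [Config.measurable_iff]
  intro B hB
  convert measurable_encard_image hF hr hinj hfin measurableSet_closeds_eq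
    (Φ := fun a x => laguerreCell x (F a))
    (measurable_laguerreCell.comp ((hF.comp measurable_fst).prodMk measurable_snd))
    (measurableSet_closeds_nonempty.inter hB) using 2 with a
  rw [Config.count]
  congr 1
  ext C
  simp only [laguerre, mem_inter_iff, mem_ofPred_eq]
  tauto

/-- Measurability of `laguerre` is available only where a rank function has finite counts on its
sublevel sets. Choosing the rank adapted to `ν` puts the Poisson process there almost surely. -/
theorem aemeasurable_laguerre {Ω : Type*} [MeasurableSpace Ω] {P : Measure Ω}
    {ν : Measure (Euc d × ℝ)} [SigmaFinite ν] {ξ : Ω → Config (Euc d × ℝ)}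
    (h : IsPoissonProcess ν ξ P) : AEMeasurable laguerre (P.map ξ) := by
  obtain ⟨r, hr, hinj, hfin⟩ := exists_injective_rank ν
  have hm : ∀ n : ℕ, MeasurableSet {x : Euc d × ℝ | r x ≤ n} := fun n =>
    measurableSet_le hr measurable_const
  let A : Set (Config (Euc d × ℝ)) := ⋂ n : ℕ, {X | X.count {x | r x ≤ n} < ⊤}
  have hA : MeasurableSet A := MeasurableSet.iInter fun n =>
    Config.measurable_count (hm n) (MeasurableSet.of_discrete (s := Iio ⊤))
  have hae : ∀ᵐ X ∂P.map ξ, X ∈ A := by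
    refine (ae_map_iff (p := fun X => X ∈ A) h.measurable.aemeasurable hA).2 ?_
    filter_upwards [ae_all_iff.2 fun n => h.ae_count_lt_top (hm n) (hfin n)] with ω hω
    exact mem_iInter.2 hω
  rw [← Measure.restrict_eq_self_of_ae_mem hae]
  refine aemeasurable_restrict_of_measurable_subtype hA ?_
  exact measurable_laguerre_comp measurable_subtype_coe hr hinj fun a => mem_iInter.1 a.2

/-- The distribution of the Laguerre diagram of a Poisson process is determined by the
intensity measure. -/
theorem IsPoissonProcess.identDistrib_laguerre {Ω Ω' : Type*} [MeasurableSpace Ω]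
    [MeasurableSpace Ω'] {P : Measure Ω} {P' : Measure Ω'} {ν : Measure (Euc d × ℝ)}
    [SigmaFinite ν] {ξ : Ω → Config (Euc d × ℝ)} {ξ' : Ω' → Config (Euc d × ℝ)}
    (h : IsPoissonProcess ν ξ P) (h' : IsPoissonProcess ν ξ' P') :
    IdentDistrib (fun ω => laguerre (ξ ω)) (fun ω => laguerre (ξ' ω)) P P' :=
  (h.identDistrib h').comp_of_aemeasurable (aemeasurable_laguerre h)

end Laguerre

/-! ### Gamma and Beta integrals on the half-line -/

section OneDimensionalIntegrals

/-- A non-integrable function has Bochner integral `0` by default, so a positive value already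
forces integrability. -/
theorem lintegral_ofReal_of_integral_pos {α : Type*} [MeasurableSpace α] {μ : Measure α}
    {f : α → ℝ} {c : ℝ} (hf : 0 ≤ᵐ[μ] f) (h : ∫ x, f x ∂μ = c) (hc : 0 < c) :
    ∫⁻ x, ENNReal.ofReal (f x) ∂μ = ENNReal.ofReal c := by
  have hi : Integrable f μ := by
    by_contra hn
    rw [integral_undef hn] at h
    exact hc.ne h
  rw [← h, ofReal_integral_eq_lintegral_ofReal hi hf]

theorem lintegral_rpow_mul_exp_neg_mul {a l : ℝ} (ha : 0 < a) (hl : 0 < l) :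
    ∫⁻ r in Ioi (0 : ℝ), ENNReal.ofReal (r ^ (a - 1) * Real.exp (-(l * r)))
      = ENNReal.ofReal ((1 / l) ^ a * Real.Gamma a) := by
  refine lintegral_ofReal_of_integral_pos ?_ (Real.integral_rpow_mul_exp_neg_mul_Ioi ha hl) ?_
  · filter_upwards [ae_restrict_mem measurableSet_Ioi] with r hr
    have : (0 : ℝ) < r := hr
    exact mul_nonneg (Real.rpow_nonneg this.le _) (Real.exp_pos _).le
  · exact mul_pos (Real.rpow_pos_of_pos (by positivity) _) (Real.Gamma_pos_of_pos ha)

theorem lintegral_rpow_mul_sub_rpow {a b s : ℝ} (ha : 0 < a) (hb : 0 < b) (hs : 0 < s) :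
    ∫⁻ r in Ioc 0 s, ENNReal.ofReal (r ^ (a - 1) * (s - r) ^ (b - 1))
      = ENNReal.ofReal (s ^ (a + b - 1) * beta a b) := by
  refine lintegral_ofReal_of_integral_pos ?_ ?_ ?_
  · filter_upwards [ae_restrict_mem measurableSet_Ioc] with r hr
    exact mul_nonneg (Real.rpow_nonneg hr.1.le _) (Real.rpow_nonneg (sub_nonneg.2 hr.2) _)
  · have h := Complex.betaIntegral_scaled a b hs
    rw [intervalIntegral.integral_of_le hs.le] at h
    have h2 : ∀ r ∈ Ioc 0 s, (r : ℂ) ^ ((a : ℂ) - 1) * ((s : ℂ) - r) ^ ((b : ℂ) - 1)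
        = ((r ^ (a - 1) * (s - r) ^ (b - 1) : ℝ) : ℂ) := fun r hr => by
      rw [Complex.ofReal_mul, Complex.ofReal_cpow hr.1.le, Complex.ofReal_cpow (sub_nonneg.2 hr.2)]
      push_cast; rfl
    rw [setIntegral_congr_fun measurableSet_Ioc h2, integral_complex_ofReal] at h
    have h3 : (s : ℂ) ^ ((a : ℂ) + b - 1) = ((s ^ (a + b - 1) : ℝ) : ℂ) := by
      rw [Complex.ofReal_cpow hs.le]; push_cast; rfl
    rw [h3] at h
    have h4 := congrArg Complex.re h
    rw [Complex.ofReal_re, Complex.re_ofReal_mul] at h4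
    rw [h4, beta_eq_betaIntegralReal a b ha hb]
  · exact mul_pos (Real.rpow_pos_of_pos hs _) (beta_pos ha hb)

/-- Write `(r + t)^(-c)` as `1 / Γ(c)` times the integral of `y^(c-1) * exp (-(r+t)*y)` and exchange
the integrals; both remaining ones are Gamma integrals. -/
theorem lintegral_rpow_mul_add_rpow {a c t : ℝ} (ha : 0 < a) (hc : a < c) (ht : 0 < t) :
    ∫⁻ r in Ioi (0 : ℝ), ENNReal.ofReal (r ^ (a - 1) * (r + t) ^ (-c))
      = ENNReal.ofReal (t ^ (a - c) * (Real.Gamma a * Real.Gamma (c - a) / Real.Gamma c)) := by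
  have hc0 : 0 < c := ha.trans hc
  have hG := Real.Gamma_pos_of_pos hc0
  have h1 : ∀ r ∈ Ioi (0 : ℝ), ENNReal.ofReal (r ^ (a - 1) * (r + t) ^ (-c))
      = ∫⁻ y in Ioi (0 : ℝ), ENNReal.ofReal
        (r ^ (a - 1) * (y ^ (c - 1) * Real.exp (-((r + t) * y))) / Real.Gamma c) := by
    intro r hr
    have hr' : (0 : ℝ) < r := hr
    have h := lintegral_rpow_mul_exp_neg_mul hc0 (add_pos hr' ht)
    have e : ∀ y, ENNReal.ofReal
        (r ^ (a - 1) * (y ^ (c - 1) * Real.exp (-((r + t) * y))) / Real.Gamma c)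
        = ENNReal.ofReal (r ^ (a - 1) / Real.Gamma c)
          * ENNReal.ofReal (y ^ (c - 1) * Real.exp (-((r + t) * y))) := fun y => by
      rw [← ENNReal.ofReal_mul (by positivity)]
      congr 1; ring
    simp_rw [e]
    rw [lintegral_const_mul _ (by fun_prop), h, ← ENNReal.ofReal_mul (by positivity)]
    congr 1
    rw [one_div, Real.inv_rpow (by positivity), ← Real.rpow_neg (by positivity)]
    field_simp
  rw [setLIntegral_congr_fun measurableSet_Ioi h1, lintegral_lintegral_swap (by fun_prop)]
  have h2 : ∀ y ∈ Ioi (0 : ℝ), ∫⁻ r in Ioi (0 : ℝ), ENNReal.ofReal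
        (r ^ (a - 1) * (y ^ (c - 1) * Real.exp (-((r + t) * y))) / Real.Gamma c)
      = ENNReal.ofReal (Real.Gamma a / Real.Gamma c)
        * ENNReal.ofReal (y ^ (c - a - 1) * Real.exp (-(t * y))) := by
    intro y hy
    have hy' : (0 : ℝ) < y := hy
    have h := lintegral_rpow_mul_exp_neg_mul ha hy'
    have e : ∀ r, ENNReal.ofReal
        (r ^ (a - 1) * (y ^ (c - 1) * Real.exp (-((r + t) * y))) / Real.Gamma c)
        = ENNReal.ofReal (y ^ (c - 1) * Real.exp (-(t * y)) / Real.Gamma c)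
          * ENNReal.ofReal (r ^ (a - 1) * Real.exp (-(y * r))) := fun r => by
      rw [← ENNReal.ofReal_mul (by positivity)]
      congr 1
      rw [show -((r + t) * y) = -(t * y) + -(y * r) by ring, Real.exp_add]
      ring
    simp_rw [e]
    rw [lintegral_const_mul _ (by fun_prop), h, ← ENNReal.ofReal_mul (by positivity),
      ← ENNReal.ofReal_mul (div_nonneg (Real.Gamma_pos_of_pos ha).le hG.le)]
    congr 1
    rw [one_div, Real.inv_rpow hy'.le, show c - a - 1 = (c - 1) - a by ring, Real.rpow_sub hy' (c - 1)]
    have := (Real.rpow_pos_of_pos hy' a).ne'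
    field_simp
  rw [setLIntegral_congr_fun measurableSet_Ioi h2, lintegral_const_mul _ (by fun_prop),
    lintegral_rpow_mul_exp_neg_mul (sub_pos.2 hc) ht,
    ← ENNReal.ofReal_mul (div_nonneg (Real.Gamma_pos_of_pos ha).le hG.le)]
  congr 1
  rw [one_div, Real.inv_rpow ht.le, ← Real.rpow_neg ht.le, neg_sub]
  ring

theorem lintegral_Ioc_const_mul_rpow {a C t : ℝ} (ha : 0 < a) (hC : 0 ≤ C) (ht : 0 ≤ t) :
    ∫⁻ r in Ioc 0 t, ENNReal.ofReal (C * r ^ (a - 1)) = ENNReal.ofReal (C * (t ^ a / a)) := by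
  have hi : IntegrableOn (fun r : ℝ => C * r ^ (a - 1)) (Ioc 0 t) := by
    have := (intervalIntegral.intervalIntegrable_rpow' (a := 0) (b := t)
      (show -1 < a - 1 by linarith)).const_mul C
    exact (intervalIntegrable_iff_integrableOn_Ioc_of_le ht).1 this
  rw [← ofReal_integral_eq_lintegral_ofReal hi]
  · rw [← intervalIntegral.integral_of_le ht, intervalIntegral.integral_const_mul,
      integral_rpow (Or.inl (by linarith))]
    simp [Real.zero_rpow ha.ne']
  · filter_upwards [ae_restrict_mem measurableSet_Ioc] with r hr
    exact mul_nonneg hC (Real.rpow_nonneg hr.1.le _)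

end OneDimensionalIntegrals

/-! ### The squared radius and its convolution with height densities -/

section RadialMeasure

/-- The function `C r ^ p` on the positive half-line. -/
noncomputable def rpowDensity (C p : ℝ) : ℝ → ℝ≥0∞ :=
  (Ioi 0).indicator fun r => ENNReal.ofReal (C * r ^ p)

theorem measurable_rpowDensity (C p : ℝ) : Measurable (rpowDensity C p) :=
  Measurable.indicator (by fun_prop) measurableSet_Ioi

/-- The constant of the radial density of Lebesgue measure in the squared radius. -/
noncomputable def radialConst (m : ℕ) : ℝ := Real.pi ^ ((m : ℝ) / 2) / Real.Gamma ((m : ℝ) / 2)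

theorem radialConst_pos {m : ℕ} (hm : 1 ≤ m) : 0 < radialConst m := by
  have : (0 : ℝ) < m := by exact_mod_cast hm
  exact div_pos (Real.rpow_pos_of_pos Real.pi_pos _) (Real.Gamma_pos_of_pos (by positivity))

/-- The distribution of the squared norm under Lebesgue measure. -/
theorem map_norm_sq_volume {m : ℕ} (hm : 1 ≤ m) :
    (volume : Measure (Euc m)).map (fun x => ‖x‖ ^ 2)
      = volume.withDensity (rpowDensity (radialConst m) ((m : ℝ) / 2 - 1)) := by
  have hm0 : (0 : ℝ) < m := by exact_mod_cast hm
  have : Nonempty (Fin m) := ⟨⟨0, hm⟩⟩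
  have hmeas : Measurable fun x : Euc m => ‖x‖ ^ 2 := by fun_prop
  have h1 : ∀ t : ℝ, (volume : Measure (Euc m)).map (fun x => ‖x‖ ^ 2) (Iic t)
      = ENNReal.ofReal (radialConst m * ((max t 0) ^ ((m : ℝ) / 2) / ((m : ℝ) / 2))) := by
    intro t
    rw [Measure.map_apply hmeas measurableSet_Iic]
    rcases lt_or_ge t 0 with ht | ht
    · have : (fun x : Euc m => ‖x‖ ^ 2) ⁻¹' Iic t = ∅ := by
        ext x
        have := sq_nonneg ‖x‖
        simp; linarith
      rw [this, max_eq_right ht.le, Real.zero_rpow (by positivity)]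
      simp
    · have : (fun x : Euc m => ‖x‖ ^ 2) ⁻¹' Iic t = Metric.closedBall 0 (√t) := by
        ext x
        simp [Real.le_sqrt (norm_nonneg x) ht]
      rw [this, EuclideanSpace.volume_closedBall, max_eq_left ht, ← ENNReal.ofReal_pow (by positivity),
        ← ENNReal.ofReal_mul (by positivity), Fintype.card_fin]
      congr 1
      have e : ∀ x : ℝ, 0 ≤ x → √x ^ m = x ^ ((m : ℝ) / 2) := fun x hx => by
        rw [Real.sqrt_eq_rpow, ← Real.rpow_natCast, ← Real.rpow_mul hx]
        congr 1; ring
      rw [e t ht, e _ Real.pi_pos.le, radialConst, Real.Gamma_add_one (by positivity)]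
      have := (Real.Gamma_pos_of_pos (show 0 < (m : ℝ) / 2 by positivity)).ne'
      field_simp
  have h2 : ∀ t : ℝ, volume.withDensity (rpowDensity (radialConst m) ((m : ℝ) / 2 - 1)) (Iic t)
      = ENNReal.ofReal (radialConst m * ((max t 0) ^ ((m : ℝ) / 2) / ((m : ℝ) / 2))) := by
    intro t
    rw [withDensity_apply _ measurableSet_Iic, rpowDensity, lintegral_indicator measurableSet_Ioi,
      Measure.restrict_restrict measurableSet_Ioi, Ioi_inter_Iic]
    rcases lt_or_ge t 0 with ht | ht
    · rw [Ioc_eq_empty (by simpa using ht.le), max_eq_right ht.le, Real.zero_rpow (by positivity)]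
      simp
    · rw [lintegral_Ioc_const_mul_rpow (by positivity) (radialConst_pos hm).le ht, max_eq_left ht]
  have h3 : ∀ {μ : Measure ℝ}, (∀ t : ℝ, μ (Iic t)
      = ENNReal.ofReal (radialConst m * ((max t 0) ^ ((m : ℝ) / 2) / ((m : ℝ) / 2)))) →
      ∀ ⦃a b : ℝ⦄, a < b → μ (Ioc a b) = μ (Iic b) - μ (Iic a) := fun h a b hab => by
    rw [← Iic_sdiff_Iic, measure_sdiff (Iic_subset_Iic.2 hab.le)
      measurableSet_Iic.nullMeasurableSet (by rw [h]; exact ENNReal.ofReal_ne_top)]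
  -- The total masses are infinite, so the comparison is made on bounded intervals, as differences
  -- of finite half-line masses.
  refine Measure.ext_of_Ioc' _ _ (fun a b hab => ?_) fun a b hab => ?_
  · rw [h3 h1 hab, h1]
    exact ne_top_of_le_ne_top ENNReal.ofReal_ne_top tsub_le_self
  · rw [h3 h1 hab, h3 h2 hab, h1, h1, h2, h2]

theorem lconvolution_rpowDensity {C p : ℝ} {f : ℝ → ℝ≥0∞} (s : ℝ) :
    lconvolution (rpowDensity C p) f volume s
      = ∫⁻ r in Ioi (0 : ℝ), ENNReal.ofReal (C * r ^ p) * f (s - r) := by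
  rw [lconvolution_def, ← lintegral_indicator measurableSet_Ioi]
  refine lintegral_congr fun r => ?_
  rw [rpowDensity, neg_add_eq_sub]
  by_cases hr : r ∈ Ioi (0 : ℝ) <;> simp [hr]

theorem lconvolution_rpowDensity_exp {C K a l : ℝ} (hC : 0 ≤ C) (hK : 0 ≤ K) (ha : 0 < a)
    (hl : 0 < l) (s : ℝ) :
    lconvolution (rpowDensity C (a - 1)) (fun h => ENNReal.ofReal (K * Real.exp (l * h))) volume s
      = ENNReal.ofReal (C * ((1 / l) ^ a * Real.Gamma a) * K * Real.exp (l * s)) := by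
  rw [lconvolution_rpowDensity]
  have e : ∀ r ∈ Ioi (0 : ℝ), ENNReal.ofReal (C * r ^ (a - 1)) * ENNReal.ofReal (K * Real.exp (l * (s - r)))
      = ENNReal.ofReal (C * K * Real.exp (l * s))
        * ENNReal.ofReal (r ^ (a - 1) * Real.exp (-(l * r))) := fun r hr => by
    have hr' : (0 : ℝ) < r := hr
    rw [← ENNReal.ofReal_mul (by positivity), ← ENNReal.ofReal_mul (by positivity),
      show l * (s - r) = l * s + -(l * r) by ring, Real.exp_add]
    congr 1; ring
  rw [setLIntegral_congr_fun measurableSet_Ioi e, lintegral_const_mul _ (by fun_prop),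
    lintegral_rpow_mul_exp_neg_mul ha hl, ← ENNReal.ofReal_mul (by positivity)]
  congr 1; ring

/-- A Beta integral over `0 < r ≤ s`. The point `s = 0` is excluded: there the left side vanishes,
while `0 ^ (a + b)` is `1` if `a + b = 0`. -/
theorem lconvolution_rpowDensity_beta {C K a b : ℝ} (hC : 0 ≤ C) (hK : 0 ≤ K) (ha : 0 < a)
    (hb : -1 < b) {s : ℝ} (hs : s ≠ 0) :
    lconvolution (rpowDensity C (a - 1)) ((Ici 0).indicator fun h => ENNReal.ofReal (K * h ^ b))
        volume s
      = (Ici 0).indicator (fun h => ENNReal.ofReal (C * K * beta a (b + 1) * h ^ (a + b))) s := by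
  rw [lconvolution_rpowDensity]
  rcases lt_or_gt_of_ne hs with hs | hs
  · rw [indicator_of_notMem (by simpa using hs)]
    rw [setLIntegral_congr_fun measurableSet_Ioi (g := fun _ => 0), lintegral_zero]
    intro r hr
    have hr' : (0 : ℝ) < r := hr
    dsimp only
    rw [indicator_of_notMem, mul_zero]
    simp only [mem_Ici, not_le]
    linarith
  · rw [indicator_of_mem (by simpa using hs.le)]
    have e : ∀ r ∈ Ioi (0 : ℝ), ENNReal.ofReal (C * r ^ (a - 1))
        * (Ici 0).indicator (fun h => ENNReal.ofReal (K * h ^ b)) (s - r)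
        = (Iic s).indicator (fun r => ENNReal.ofReal (C * K)
          * ENNReal.ofReal (r ^ (a - 1) * (s - r) ^ (b + 1 - 1))) r := fun r hr => by
      have hr' : (0 : ℝ) < r := hr
      by_cases h : r ≤ s
      · rw [indicator_of_mem (by simpa using h), indicator_of_mem (by simpa using h),
          ← ENNReal.ofReal_mul (by positivity), ← ENNReal.ofReal_mul (by positivity),
          add_sub_cancel_right]
        congr 1; ring
      · rw [indicator_of_notMem (by simpa using h), indicator_of_notMem (by simpa using h), mul_zero]
    rw [setLIntegral_congr_fun measurableSet_Ioi e, lintegral_indicator measurableSet_Iic,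
      Measure.restrict_restrict measurableSet_Iic, inter_comm, Ioi_inter_Iic,
      lintegral_const_mul _ (by fun_prop),
      lintegral_rpow_mul_sub_rpow ha (by linarith) hs, ← ENNReal.ofReal_mul (by positivity)]
    congr 1
    rw [show a + (b + 1) - 1 = a + b by ring]
    ring

/-- For `s < 0` every `s - r` with `r > 0` is negative, so the indicator disappears. Values at `s ≥
0` concern only the discarded points. -/
theorem lconvolution_rpowDensity_betaPrime {C K a b : ℝ} (hC : 0 ≤ C) (hK : 0 ≤ K) (ha : 0 < a)
    (hb : a < b) {s : ℝ} (hs : s < 0) :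
    lconvolution (rpowDensity C (a - 1))
        ((Iio 0).indicator fun h => ENNReal.ofReal (K * (-h) ^ (-b))) volume s
      = ENNReal.ofReal (C * K * (Real.Gamma a * Real.Gamma (b - a) / Real.Gamma b)
        * (-s) ^ (-(b - a))) := by
  rw [lconvolution_rpowDensity]
  have e : ∀ r ∈ Ioi (0 : ℝ), ENNReal.ofReal (C * r ^ (a - 1))
      * (Iio 0).indicator (fun h => ENNReal.ofReal (K * (-h) ^ (-b))) (s - r)
      = ENNReal.ofReal (C * K) * ENNReal.ofReal (r ^ (a - 1) * (r + -s) ^ (-b)) := fun r hr => by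
    have hr' : (0 : ℝ) < r := hr
    rw [indicator_of_mem (by simp only [mem_Iio]; linarith), ← ENNReal.ofReal_mul (by positivity),
      ← ENNReal.ofReal_mul (by positivity), show -(s - r) = r + -s by ring]
    congr 1; ring
  rw [setLIntegral_congr_fun measurableSet_Ioi e, lintegral_const_mul _ (by fun_prop),
    lintegral_rpow_mul_add_rpow ha hb (neg_pos.2 hs), ← ENNReal.ofReal_mul (by positivity), neg_sub]
  congr 1; ring

end RadialMeasure

/-! ### Sections of Laguerre diagrams, for fixed configurations -/

section Splitting

variable {ℓ m : ℕ}

/-- The first `ℓ` and the last `m` coordinates of a vector. -/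
noncomputable def splitCoords (ℓ m : ℕ) (x : Euc (ℓ + m)) : Euc ℓ × Euc m :=
  (WithLp.toLp 2 fun i => x (Fin.castAdd m i), WithLp.toLp 2 fun j => x (Fin.natAdd ℓ j))

theorem measurePreserving_splitCoords : MeasurePreserving (splitCoords ℓ m) volume volume := by
  have h1 := PiLp.volume_preserving_ofLp (Fin (ℓ + m))
  have h2 := (volume_measurePreserving_piCongrLeft (fun _ : Fin (ℓ + m) => ℝ)
    (finSumFinEquiv (m := ℓ) (n := m))).symm
  have h3 := volume_measurePreserving_sumPiEquivProdPi (fun _ : Fin ℓ ⊕ Fin m => ℝ)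
  have h4 := (PiLp.volume_preserving_toLp (Fin ℓ)).prod (PiLp.volume_preserving_toLp (Fin m))
  have h := h4.comp (h3.comp (h2.comp h1))
  have e : splitCoords ℓ m = Prod.map (WithLp.toLp 2) (WithLp.toLp 2) ∘
      (MeasurableEquiv.sumPiEquivProdPi fun _ : Fin ℓ ⊕ Fin m => ℝ) ∘
      (MeasurableEquiv.piCongrLeft (fun _ : Fin (ℓ + m) => ℝ) finSumFinEquiv).symm ∘
      WithLp.ofLp := rfl
  rw [e]
  exact h

theorem norm_sub_embed_sq (w : Euc ℓ) (v : Euc (ℓ + m)) :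
    ‖embed ℓ (ℓ + m) w - v‖ ^ 2
      = ‖w - (splitCoords ℓ m v).1‖ ^ 2 + ‖(splitCoords ℓ m v).2‖ ^ 2 := by
  simp [EuclideanSpace.real_norm_sq_eq, Fin.sum_univ_add, embed, splitCoords]

/-- The projection of weighted points which turns sections of Laguerre diagrams into Laguerre
diagrams. -/
noncomputable def sectionPoint (ℓ m : ℕ) (x : Euc (ℓ + m) × ℝ) : Euc ℓ × ℝ :=
  ((splitCoords ℓ m x.1).1, ‖(splitCoords ℓ m x.1).2‖ ^ 2 + x.2)

theorem power_embed (w : Euc ℓ) (x : Euc (ℓ + m) × ℝ) :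
    power (embed ℓ (ℓ + m) w) x = power w (sectionPoint ℓ m x) := by
  rw [power, power, norm_sub_embed_sq, sectionPoint, add_assoc]

theorem measurable_sectionPoint : Measurable (sectionPoint ℓ m) := by
  have h : Measurable (splitCoords ℓ m) := measurePreserving_splitCoords.measurable
  have h' : Measurable fun x : Euc (ℓ + m) × ℝ => splitCoords ℓ m x.1 := h.comp measurable_fst
  exact (measurable_fst.comp h').prodMk
    (((measurable_snd.comp h').norm.pow_const 2).add measurable_snd)

theorem laguerreCell_preimage_embed (x : Euc (ℓ + m) × ℝ) (X : Config (Euc (ℓ + m) × ℝ)) :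
    (laguerreCell x X).preimage (continuous_embed ℓ (ℓ + m))
      = laguerreCell (sectionPoint ℓ m x) (X.mapOn (sectionPoint ℓ m) univ) := by
  refine SetLike.coe_injective ?_
  ext w
  change (∀ y ∈ X.pts, power (embed ℓ (ℓ + m) w) x ≤ power (embed ℓ (ℓ + m) w) y) ↔
    ∀ y ∈ sectionPoint ℓ m '' X.pts ∩ univ, power w (sectionPoint ℓ m x) ≤ power w y
  rw [inter_univ, forall_mem_image]
  simp_rw [power_embed]

theorem sectionWith_laguerre (X : Config (Euc (ℓ + m) × ℝ)) :
    sectionWith ℓ (laguerre X) = laguerre (X.mapOn (sectionPoint ℓ m) univ) := by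
  ext C
  constructor
  · rintro ⟨hC, c, ⟨hc, x, hx, rfl⟩, rfl⟩
    exact ⟨hC, sectionPoint ℓ m x, ⟨mem_image_of_mem _ hx, trivial⟩, laguerreCell_preimage_embed x X⟩
  · rintro ⟨hC, _, ⟨⟨x, hx, rfl⟩, -⟩, rfl⟩
    rw [← laguerreCell_preimage_embed] at hC ⊢
    refine ⟨hC, laguerreCell x X, ⟨?_, x, hx, rfl⟩, rfl⟩
    -- A cell with non-empty section is itself non-empty.
    obtain ⟨w, hw⟩ := hC
    exact ⟨_, hw⟩

/-- Comparing distances is the same as comparing their squares, so Voronoi cells are Laguerre cells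
of points of height `0`; this serves `β = -1`. -/
theorem sectionWith_voronoi (Y : Config (Euc (ℓ + m))) :
    sectionWith ℓ (voronoi Y)
      = laguerre (Y.mapOn (fun v => sectionPoint ℓ m (v, 0)) univ) := by
  have key : ∀ v, (voronoiCell v Y).preimage (continuous_embed ℓ (ℓ + m))
      = laguerreCell (sectionPoint ℓ m (v, 0)) (Y.mapOn (fun v => sectionPoint ℓ m (v, 0)) univ) := by
    intro v
    refine SetLike.coe_injective ?_
    ext w
    change (∀ y ∈ Y.pts, ‖embed ℓ (ℓ + m) w - v‖ ≤ ‖embed ℓ (ℓ + m) w - y‖) ↔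
      ∀ y ∈ (fun v => sectionPoint ℓ m (v, 0)) '' Y.pts ∩ univ,
        power w (sectionPoint ℓ m (v, 0)) ≤ power w y
    rw [inter_univ, forall_mem_image]
    simp_rw [← power_embed, power, add_zero]
    refine forall₂_congr fun y _ => ?_
    exact (pow_le_pow_iff_left₀ (norm_nonneg _) (norm_nonneg _) two_ne_zero).symm
  ext C
  constructor
  · rintro ⟨hC, c, ⟨v, hv, rfl⟩, rfl⟩
    exact ⟨hC, _, ⟨mem_image_of_mem _ hv, trivial⟩, key v⟩
  · rintro ⟨hC, _, ⟨⟨v, hv, rfl⟩, -⟩, rfl⟩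
    exact ⟨hC, _, ⟨v, hv, rfl⟩, (key v).symm⟩

/-- Points of nonnegative weight are irrelevant if all points of the space have negative power with
respect to some weighted point. -/
theorem laguerre_eq_of_forall_power_neg {d : ℕ} {X Y : Config (Euc d × ℝ)}
    (hY : Y.pts = X.pts ∩ {x | x.2 < 0}) (hcov : ∀ w, ∃ y ∈ Y.pts, power w y < 0) :
    laguerre X = laguerre Y := by
  have hnn : ∀ w, ∀ x : Euc d × ℝ, 0 ≤ x.2 → 0 ≤ power w x := fun w x hx =>
    add_nonneg (sq_nonneg _) hx
  have hYX : ∀ y ∈ Y.pts, y ∈ X.pts := fun y hy => by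
    rw [hY] at hy; exact hy.1
  have hcell : ∀ x, laguerreCell x X = laguerreCell x Y := by
    intro x
    refine SetLike.coe_injective ?_
    ext w
    refine ⟨fun h y hy => h y (hYX y hy), fun h y hy => ?_⟩
    rcases lt_or_ge y.2 0 with hy0 | hy0
    · exact h y (by rw [hY]; exact ⟨hy, hy0⟩)
    · obtain ⟨z, hz, hz0⟩ := hcov w
      exact (h z hz).trans (hz0.le.trans (hnn w y hy0))
  ext C
  constructor
  · rintro ⟨hC, x, hx, rfl⟩
    refine ⟨hC, x, ?_, hcell x⟩
    rw [hY]
    refine ⟨hx, ?_⟩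
    obtain ⟨w, hw⟩ := hC
    obtain ⟨z, hz, hz0⟩ := hcov w
    -- A point of nonnegative height has nonnegative power everywhere, so it is beaten at `w` by the
    -- point `z` of negative power.
    by_contra hx0
    exact absurd (hw z (hYX z hz)) (not_le.2 (hz0.trans_le (hnn w x (not_lt.1 hx0))))
  · rintro ⟨hC, x, hx, rfl⟩
    exact ⟨hC, x, hYX x hx, (hcell x).symm⟩

theorem laguerre_mapOn_shift {d : ℕ} (X : Config (Euc d × ℝ)) (c : ℝ) :
    laguerre (X.mapOn (fun x => (x.1, x.2 + c)) univ) = laguerre X := by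
  have hcell : ∀ x : Euc d × ℝ, laguerreCell (x.1, x.2 + c) (X.mapOn (fun x => (x.1, x.2 + c)) univ)
      = laguerreCell x X := by
    intro x
    refine SetLike.coe_injective ?_
    ext w
    change (∀ y ∈ (fun x : Euc d × ℝ => (x.1, x.2 + c)) '' X.pts ∩ univ,
      power w (x.1, x.2 + c) ≤ power w y) ↔ ∀ y ∈ X.pts, power w x ≤ power w y
    rw [inter_univ, forall_mem_image]
    simp [power, ← add_assoc]
  ext C
  constructor
  · rintro ⟨hC, _, ⟨⟨x, hx, rfl⟩, -⟩, rfl⟩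
    exact ⟨hC, x, hx, hcell x⟩
  · rintro ⟨hC, x, hx, rfl⟩
    exact ⟨hC, _, ⟨mem_image_of_mem _ hx, trivial⟩, (hcell x).symm⟩

end Splitting

/-! ### Image intensities and their constants -/

section Intensities

variable {ℓ m : ℕ}

/-- The first `ℓ` coordinates are untouched; the last `m` enter only through their squared norm,
which is added to the height, whence a convolution. -/
theorem map_sectionPoint_prod (hm : 1 ≤ m) {f : ℝ → ℝ≥0∞} (hf : Measurable f) :
    ((volume : Measure (Euc (ℓ + m))).prod (volume.withDensity f)).map (sectionPoint ℓ m)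
      = (volume : Measure (Euc ℓ)).prod (volume.withDensity
        (lconvolution (rpowDensity (radialConst m) ((m : ℝ) / 2 - 1)) f volume)) := by
  have hn : Measurable fun x : Euc m => ‖x‖ ^ 2 := by fun_prop
  rw [← conv_withDensity_eq_lconvolution (measurable_rpowDensity _ _) hf,
    ← map_norm_sq_volume hm]
  set τ := volume.withDensity f
  have h1 := (measurePreserving_splitCoords (ℓ := ℓ) (m := m)).prod (MeasurePreserving.id τ)
  have h2 : MeasurePreserving (MeasurableEquiv.prodAssoc (α := Euc ℓ) (β := Euc m) (γ := ℝ))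
    ((volume.prod volume).prod τ) (volume.prod (volume.prod τ)) :=
    measurePreserving_prodAssoc _ _ _
  have h3 : MeasurePreserving (Prod.map (fun x : Euc m => ‖x‖ ^ 2) (id : ℝ → ℝ))
      (volume.prod τ) (((volume : Measure (Euc m)).map fun x => ‖x‖ ^ 2).prod τ) := by
    have : SFinite ((volume : Measure (Euc m)).map fun x => ‖x‖ ^ 2) := inferInstance
    exact (hn.measurePreserving volume).prod (MeasurePreserving.id τ)
  have h4 : MeasurePreserving (fun p : ℝ × ℝ => p.1 + p.2)
      (((volume : Measure (Euc m)).map fun x => ‖x‖ ^ 2).prod τ)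
      (((volume : Measure (Euc m)).map fun x => ‖x‖ ^ 2) ∗ τ) :=
    ⟨by fun_prop, rfl⟩
  have h5 := (MeasurePreserving.id (volume : Measure (Euc ℓ))).prod (h4.comp h3)
  have h6 := h5.comp (h2.comp h1)
  exact h6.map_eq

theorem map_sectionPoint_volume (hm : 1 ≤ m) :
    (volume : Measure (Euc (ℓ + m))).map (fun v => sectionPoint ℓ m (v, 0))
      = (volume : Measure (Euc ℓ)).prod (volume.withDensity
        (rpowDensity (radialConst m) ((m : ℝ) / 2 - 1))) := by
  have hn : Measurable fun x : Euc m => ‖x‖ ^ 2 := by fun_prop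
  rw [← map_norm_sq_volume hm]
  have h1 := (MeasurePreserving.id (volume : Measure (Euc ℓ))).prod (hn.measurePreserving volume)
  have h2 := h1.comp (measurePreserving_splitCoords (ℓ := ℓ) (m := m))
  rw [← h2.map_eq]
  congr 1
  ext v : 1
  simp [sectionPoint, Prod.map]

theorem betaIntensity_eq_prod (d : ℕ) (β γ : ℝ) :
    betaIntensity d β γ = volume.prod (volume.withDensity
      ((Ici 0).indicator fun h => ENNReal.ofReal (γ * betaConst (d + 1) β * h ^ β))) := by
  rw [prod_withDensity_right (Measurable.indicator (by fun_prop) measurableSet_Ici), betaIntensity,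
    ← withDensity_indicator (measurableSet_le measurable_const measurable_snd)]
  rfl

theorem betaPrimeIntensity_eq_prod (d : ℕ) (β γ : ℝ) :
    betaPrimeIntensity d β γ = volume.prod (volume.withDensity
      ((Iio 0).indicator fun h => ENNReal.ofReal (γ * betaPrimeConst (d + 1) β * (-h) ^ (-β)))) := by
  rw [prod_withDensity_right (Measurable.indicator (by fun_prop) measurableSet_Iio),
    betaPrimeIntensity, ← withDensity_indicator (measurableSet_lt measurable_snd measurable_const)]
  rfl

theorem gaussianIntensity_eq_prod (d : ℕ) (lam γ : ℝ) :
    gaussianIntensity d lam γ = volume.prod (volume.withDensity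
      fun h => ENNReal.ofReal (γ * Real.exp (lam * h))) := by
  rw [prod_withDensity_right (by fun_prop), gaussianIntensity]
  rfl

/-- Supplies the null level sets, for the height function, that the mapping theorem requires. -/
theorem prod_withDensity_preimage_snd_singleton {d : ℕ} (f : ℝ → ℝ≥0∞) (c : ℝ) :
    ((volume : Measure (Euc d)).prod (volume.withDensity f)) (Prod.snd ⁻¹' {c}) = 0 := by
  rw [← univ_prod, Measure.prod_prod,
    withDensity_absolutelyContinuous _ _ (measure_singleton c), mul_zero]

instance sigmaFinite_betaIntensity (d : ℕ) (β γ : ℝ) : SigmaFinite (betaIntensity d β γ) :=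
  SigmaFinite.withDensity_ofReal _

instance sigmaFinite_betaPrimeIntensity (d : ℕ) (β γ : ℝ) :
    SigmaFinite (betaPrimeIntensity d β γ) :=
  SigmaFinite.withDensity_ofReal _

instance sigmaFinite_gaussianIntensity (d : ℕ) (lam γ : ℝ) :
    SigmaFinite (gaussianIntensity d lam γ) :=
  SigmaFinite.withDensity_ofReal _

theorem betaConst_pos (n : ℕ) {β : ℝ} (hβ : -1 < β) : 0 < betaConst n β := by
  have : (0 : ℝ) ≤ n := n.cast_nonneg
  exact div_pos (Real.Gamma_pos_of_pos (by linarith [show (0:ℝ) ≤ n / 2 by positivity]))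
    (mul_pos (Real.rpow_pos_of_pos Real.pi_pos _) (Real.Gamma_pos_of_pos (by linarith)))

theorem betaPrimeConst_pos (n : ℕ) {β : ℝ} (hβ : (n : ℝ) / 2 < β) : 0 < betaPrimeConst n β := by
  have : (0 : ℝ) ≤ (n : ℝ) / 2 := by positivity
  exact div_pos (Real.Gamma_pos_of_pos (by linarith))
    (mul_pos (Real.rpow_pos_of_pos Real.pi_pos _) (Real.Gamma_pos_of_pos (by linarith)))

theorem radialConst_mul_betaConst (hm : 1 ≤ m) {β : ℝ} (hβ : -1 < β) :
    radialConst m * betaConst (ℓ + m + 1) β * beta ((m : ℝ) / 2) (β + 1)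
      = betaConst (ℓ + 1) (β + (m : ℝ) / 2) := by
  have hm0 : (0 : ℝ) < m := by exact_mod_cast hm
  have g1 := (Real.Gamma_pos_of_pos (show 0 < (m : ℝ) / 2 by positivity)).ne'
  have g2 := (Real.Gamma_pos_of_pos (show 0 < β + 1 by linarith)).ne'
  have g3 := (Real.Gamma_pos_of_pos (show 0 < (m : ℝ) / 2 + (β + 1) by
    linarith [show (0 : ℝ) < m / 2 by positivity])).ne'
  have p1 := (Real.rpow_pos_of_pos Real.pi_pos ((m : ℝ) / 2)).ne'
  have p2 := (Real.rpow_pos_of_pos Real.pi_pos (((ℓ : ℝ) + 1) / 2)).ne'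
  have e1 : ((ℓ + m + 1 : ℕ) : ℝ) / 2 = ((ℓ : ℝ) + 1) / 2 + (m : ℝ) / 2 := by push_cast; ring
  rw [radialConst, betaConst, betaConst, beta, e1, Real.rpow_add Real.pi_pos]
  push_cast
  rw [show ((ℓ : ℝ) + 1) / 2 + (m : ℝ) / 2 + β + 1 = ((ℓ : ℝ) + 1) / 2 + (β + (m : ℝ) / 2) + 1 by ring,
    show β + (m : ℝ) / 2 + 1 = (m : ℝ) / 2 + (β + 1) by ring]
  field_simp

theorem radialConst_mul_betaPrimeConst (hm : 1 ≤ m) {β : ℝ} (hβ : (m : ℝ) / 2 < β) :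
    radialConst m * betaPrimeConst (ℓ + m + 1) β
        * (Real.Gamma ((m : ℝ) / 2) * Real.Gamma (β - (m : ℝ) / 2) / Real.Gamma β)
      = betaPrimeConst (ℓ + 1) (β - (m : ℝ) / 2) := by
  have hm0 : (0 : ℝ) < m := by exact_mod_cast hm
  have g1 := (Real.Gamma_pos_of_pos (show 0 < (m : ℝ) / 2 by positivity)).ne'
  have g2 := (Real.Gamma_pos_of_pos (show 0 < β by linarith [show (0 : ℝ) < m / 2 by positivity])).ne'
  have p1 := (Real.rpow_pos_of_pos Real.pi_pos ((m : ℝ) / 2)).ne'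
  have p2 := (Real.rpow_pos_of_pos Real.pi_pos (((ℓ : ℝ) + 1) / 2)).ne'
  have e1 : ((ℓ + m + 1 : ℕ) : ℝ) / 2 = ((ℓ : ℝ) + 1) / 2 + (m : ℝ) / 2 := by push_cast; ring
  rw [radialConst, betaPrimeConst, betaPrimeConst, e1, Real.rpow_add Real.pi_pos]
  push_cast
  rw [show β - (((ℓ : ℝ) + 1) / 2 + (m : ℝ) / 2) = β - (m : ℝ) / 2 - ((ℓ : ℝ) + 1) / 2 by ring]
  field_simp

theorem voronoiConst_mul_radialConst (hm : 1 ≤ m) :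
    voronoiConst (ℓ + m) * radialConst m = betaConst (ℓ + 1) (-1 + (m : ℝ) / 2) := by
  have hm0 : (0 : ℝ) < m := by exact_mod_cast hm
  have p1 := (Real.rpow_pos_of_pos Real.pi_pos ((m : ℝ) / 2)).ne'
  have p2 := (Real.rpow_pos_of_pos Real.pi_pos (((ℓ : ℝ) + 1) / 2)).ne'
  have e1 : (((ℓ + m : ℕ) : ℝ) + 1) / 2 = ((ℓ : ℝ) + 1) / 2 + (m : ℝ) / 2 := by push_cast; ring
  rw [radialConst, voronoiConst, betaConst, e1, Real.rpow_neg Real.pi_pos.le,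
    Real.rpow_add Real.pi_pos]
  push_cast
  rw [show ((ℓ : ℝ) + 1) / 2 + (-1 + (m : ℝ) / 2) + 1 = ((ℓ : ℝ) + 1) / 2 + (m : ℝ) / 2 by ring,
    show -1 + (m : ℝ) / 2 + 1 = (m : ℝ) / 2 by ring]
  field_simp

theorem map_sectionPoint_betaIntensity (hm : 1 ≤ m) {β γ : ℝ} (hβ : -1 < β) (hγ : 0 < γ) :
    (betaIntensity (ℓ + m) β γ).map (sectionPoint ℓ m)
      = betaIntensity ℓ (β + (m : ℝ) / 2) γ := by
  have hm0 : (0 : ℝ) < m := by exact_mod_cast hm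
  rw [betaIntensity_eq_prod, betaIntensity_eq_prod,
    map_sectionPoint_prod hm (Measurable.indicator (by fun_prop) measurableSet_Ici)]
  congr 1
  -- The densities may disagree at height `0`, a null set.
  refine withDensity_congr_ae ?_
  filter_upwards [compl_mem_ae_iff.2 (measure_singleton (μ := (volume : Measure ℝ)) 0)] with s hs
  rw [lconvolution_rpowDensity_beta (radialConst_pos hm).le
    (mul_pos hγ (betaConst_pos _ hβ)).le (by positivity) hβ hs]
  rw [← radialConst_mul_betaConst (ℓ := ℓ) hm hβ, add_comm β]
  congr 1
  ext h
  congr 1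
  ring_nf

theorem map_sectionPoint_voronoi (hm : 1 ≤ m) {γ : ℝ} (hγ : 0 < γ) :
    (ENNReal.ofReal (voronoiConst (ℓ + m) * γ) • (volume : Measure (Euc (ℓ + m)))).map
        (fun v => sectionPoint ℓ m (v, 0))
      = betaIntensity ℓ (-1 + (m : ℝ) / 2) γ := by
  have hv : 0 ≤ voronoiConst (ℓ + m) := by
    have := Real.pi_pos
    exact mul_nonneg (Real.Gamma_pos_of_pos (by positivity)).le (by positivity)
  rw [Measure.map_smul, map_sectionPoint_volume hm, betaIntensity_eq_prod, ← Measure.prod_smul_right,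
    ← withDensity_smul _ (measurable_rpowDensity _ _)]
  congr 1
  refine withDensity_congr_ae ?_
  filter_upwards [compl_mem_ae_iff.2 (measure_singleton (μ := (volume : Measure ℝ)) 0)] with s hs
  have hs0 : s ≠ 0 := hs
  simp only [Pi.smul_apply, smul_eq_mul, rpowDensity]
  by_cases h : 0 < s
  · rw [indicator_of_mem (by simpa using h), indicator_of_mem (by simpa using h.le),
      ← ENNReal.ofReal_mul (by positivity), ← voronoiConst_mul_radialConst hm]
    congr 1
    rw [show (m : ℝ) / 2 - 1 = -1 + (m : ℝ) / 2 by ring]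
    ring
  · have h' : ¬ 0 ≤ s := fun h' => h (lt_of_le_of_ne h' hs0.symm)
    rw [indicator_of_notMem (by simpa using h), indicator_of_notMem (by simpa using h'), mul_zero]

theorem map_sectionPoint_betaPrimeIntensity (hm : 1 ≤ m) {β γ : ℝ}
    (hβ : ((ℓ + m + 1 : ℕ) : ℝ) / 2 < β) (hγ : 0 < γ) :
    ((betaPrimeIntensity (ℓ + m) β γ).map (sectionPoint ℓ m)).restrict {x | x.2 < 0}
      = betaPrimeIntensity ℓ (β - (m : ℝ) / 2) γ := by
  have hm0 : (0 : ℝ) < m := by exact_mod_cast hm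
  have hmβ : (m : ℝ) / 2 < β := by
    refine lt_of_le_of_lt ?_ hβ
    push_cast
    have : (0 : ℝ) ≤ ℓ := ℓ.cast_nonneg
    linarith
  rw [betaPrimeIntensity_eq_prod, betaPrimeIntensity_eq_prod,
    map_sectionPoint_prod hm (Measurable.indicator (by fun_prop) measurableSet_Iio)]
  have : {x : Euc ℓ × ℝ | x.2 < 0} = univ ×ˢ Iio 0 := by ext; simp
  rw [this, ← Measure.prod_restrict, Measure.restrict_univ, restrict_withDensity measurableSet_Iio,
    withDensity_indicator measurableSet_Iio]
  congr 1
  refine withDensity_congr_ae ?_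
  filter_upwards [ae_restrict_mem measurableSet_Iio] with s hs
  rw [lconvolution_rpowDensity_betaPrime (radialConst_pos hm).le
    (mul_pos hγ (betaPrimeConst_pos _ hβ)).le (by positivity) hmβ hs,
    ← radialConst_mul_betaPrimeConst (ℓ := ℓ) hm hmβ]
  congr 1
  ring

theorem map_sectionPoint_gaussianIntensity (hm : 1 ≤ m) {lam γ : ℝ} (hl : 0 < lam) (hγ : 0 < γ) :
    ∃ γ' > 0, (gaussianIntensity (ℓ + m) lam γ).map (sectionPoint ℓ m)
      = gaussianIntensity ℓ lam γ' := by
  have hm0 : (0 : ℝ) < m := by exact_mod_cast hm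
  have hr := radialConst_pos hm
  have hG := Real.Gamma_pos_of_pos (show 0 < (m : ℝ) / 2 by positivity)
  refine ⟨radialConst m * ((1 / lam) ^ ((m : ℝ) / 2) * Real.Gamma ((m : ℝ) / 2)) * γ,
    by positivity, ?_⟩
  rw [gaussianIntensity_eq_prod, gaussianIntensity_eq_prod, map_sectionPoint_prod hm (by fun_prop)]
  congr 2
  ext s
  exact lconvolution_rpowDensity_exp hr.le hγ.le (by positivity) hl s

/-- Translating the height multiplies an exponential density by a constant, so all values of `γ` are
related by shifts. -/
theorem map_shift_gaussianIntensity (d : ℕ) (lam γ c : ℝ) :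
    (gaussianIntensity d lam γ).map (fun x => (x.1, x.2 + c))
      = gaussianIntensity d lam (γ * Real.exp (-(lam * c))) := by
  rw [gaussianIntensity_eq_prod, gaussianIntensity_eq_prod]
  have h : MeasurePreserving (fun h : ℝ => h + c)
      (volume.withDensity fun h => ENNReal.ofReal (γ * Real.exp (lam * h)))
      (volume.withDensity fun h => ENNReal.ofReal (γ * Real.exp (-(lam * c)) * Real.exp (lam * h))) := by
    refine ⟨by fun_prop, ?_⟩
    ext B hB
    rw [Measure.map_apply (by fun_prop) hB, withDensity_apply _ hB,
      withDensity_apply _ (measurable_add_const c hB),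
      ← (measurePreserving_add_right (volume : Measure ℝ) c).setLIntegral_comp_preimage hB
        (by fun_prop)]
    refine lintegral_congr fun h => ?_
    rw [mul_assoc, ← Real.exp_add]
    congr 3; ring
  exact ((MeasurePreserving.id (volume : Measure (Euc d))).prod h).map_eq

end Intensities

/-! ### Covering of space by points of negative height -/

theorem poissonLaw_zero_le {a : ℝ≥0∞} {r : ℝ} (h : ENNReal.ofReal r ≤ a) :
    poissonLaw a {0} ≤ ENNReal.ofReal (Real.exp (-r)) := by
  by_cases ha : a = ∞
  · simp [poissonLaw, ha]
  · rw [poissonLaw_zero_singleton ha]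
    refine ENNReal.ofReal_le_ofReal (Real.exp_le_exp.2 (neg_le_neg ?_))
    exact (ENNReal.ofReal_le_iff_le_toReal ha).1 h

theorem tendsto_pow_mul_exp_neg_rpow {C K p : ℝ} (d : ℕ) (hK : 0 < K) (hp : 0 < p) :
    Tendsto (fun n : ℕ => C * ((n : ℝ) ^ d * Real.exp (-(K * (n : ℝ) ^ p)))) atTop (𝓝 0) := by
  have h1 := tendsto_rpow_mul_exp_neg_mul_atTop_nhds_zero (d / p) K hK
  have h2 : Tendsto (fun n : ℕ => (n : ℝ) ^ p) atTop atTop :=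
    (tendsto_rpow_atTop hp).comp tendsto_natCast_atTop_atTop
  have h3 := (h1.comp h2).const_mul C
  rw [mul_zero] at h3
  refine h3.congr fun n => ?_
  simp only [Function.comp]
  rw [← Real.rpow_mul n.cast_nonneg, mul_div_cancel₀ _ hp.ne', Real.rpow_natCast, neg_mul]

section Covering

variable {d : ℕ}

/-- The cube of side length `1 / n` with lower corner `k / n`. -/
def gridCube (n : ℕ) (k : Fin d → ℤ) : Set (Euc d) :=
  {v | ∀ i, v i ∈ Ico ((k i : ℝ) / n) ((k i : ℝ) / n + 1 / n)}

theorem measurableSet_gridCube (n : ℕ) (k : Fin d → ℤ) : MeasurableSet (gridCube n k) := by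
  have : gridCube n k = ⋂ i, {v : Euc d | v i ∈ Ico ((k i : ℝ) / n) ((k i : ℝ) / n + 1 / n)} := by
    ext; simp [gridCube]
  rw [this]
  refine MeasurableSet.iInter fun i => ?_
  have hi : Measurable fun v : Euc d => v i := by fun_prop
  exact hi measurableSet_Ico

theorem volume_gridCube (n : ℕ) (k : Fin d → ℤ) :
    volume (gridCube n k) = ENNReal.ofReal ((1 / (n : ℝ)) ^ d) := by
  have : gridCube n k = WithLp.ofLp ⁻¹'
      (univ.pi fun i => Ico ((k i : ℝ) / n) ((k i : ℝ) / n + 1 / n)) := by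
    ext; simp [gridCube]
  rw [this, (PiLp.volume_preserving_ofLp (Fin d)).measure_preimage
    (MeasurableSet.univ_pi fun i => measurableSet_Ico).nullMeasurableSet, Real.volume_pi_Ico]
  simp only [add_sub_cancel_left, Finset.prod_const, Finset.card_univ, Fintype.card_fin]
  rw [ENNReal.ofReal_pow (by positivity)]

theorem mem_gridCube_floor {n : ℕ} (hn : 0 < n) (w : Euc d) :
    w ∈ gridCube n fun i => ⌊(n : ℝ) * w i⌋ := by
  have hn' : (0 : ℝ) < n := by exact_mod_cast hn
  intro i
  refine ⟨?_, ?_⟩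
  · rw [div_le_iff₀ hn', mul_comm]
    exact Int.floor_le _
  · rw [← add_div, lt_div_iff₀ hn', mul_comm]
    exact Int.lt_floor_add_one _

theorem norm_sub_sq_le_of_mem_gridCube {n : ℕ} {k : Fin d → ℤ} {v w : Euc d}
    (hv : v ∈ gridCube n k) (hw : w ∈ gridCube n k) : ‖w - v‖ ^ 2 ≤ d * (1 / (n : ℝ)) ^ 2 := by
  rw [EuclideanSpace.real_norm_sq_eq]
  have : ∀ i ∈ Finset.univ, (w - v) i ^ 2 ≤ (1 / (n : ℝ)) ^ 2 := fun i _ => by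
    have h1 := hv i
    have h2 := hw i
    refine sq_le_sq' ?_ ?_ <;> simp only [PiLp.sub_apply] <;> linarith [h1.1, h1.2, h2.1, h2.2]
  simpa using Finset.sum_le_card_nsmul _ _ _ this

/-- On this slab `-h < 2 * t`, and the density decreases in `-h`, so it is bounded below by its
value at `h = -2 * t`. -/
theorem le_betaPrimeIntensity_prod {β γ t : ℝ} (hβ : ((d + 1 : ℕ) : ℝ) / 2 < β) (hγ : 0 < γ)
    (ht : 0 < t) {Q : Set (Euc d)} :
    volume Q * ENNReal.ofReal (γ * betaPrimeConst (d + 1) β * (2 * t) ^ (-β) * t)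
      ≤ betaPrimeIntensity d β γ (Q ×ˢ Ioo (-(2 * t)) (-t)) := by
  have hc := betaPrimeConst_pos (d + 1) hβ
  have hβ0 : 0 < β := lt_of_le_of_lt (by positivity) hβ
  rw [betaPrimeIntensity_eq_prod, Measure.prod_prod, withDensity_apply _ measurableSet_Ioo]
  gcongr
  calc ENNReal.ofReal (γ * betaPrimeConst (d + 1) β * (2 * t) ^ (-β) * t)
      = ∫⁻ _ in Ioo (-(2 * t)) (-t), ENNReal.ofReal (γ * betaPrimeConst (d + 1) β * (2 * t) ^ (-β)) := by
        rw [setLIntegral_const, Real.volume_Ioo, ← ENNReal.ofReal_mul (by positivity)]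
        congr 1; ring
    _ ≤ _ := by
        refine setLIntegral_mono' measurableSet_Ioo fun h hh => ?_
        have h0 : h < 0 := hh.2.trans (by linarith)
        rw [indicator_of_mem (by simpa using h0)]
        refine ENNReal.ofReal_le_ofReal (mul_le_mul_of_nonneg_left ?_ (by positivity))
        exact Real.rpow_le_rpow_of_nonpos (by linarith) (by linarith [hh.1]) (by linarith)

/-- Almost surely, every point of the space has negative power with respect to some point of the
Poisson process underlying the `β'`-Voronoi tessellation. -/
theorem IsPoissonProcess.ae_forall_exists_power_neg {Ω : Type*} [MeasurableSpace Ω] {P : Measure Ω}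
    {β γ : ℝ} (hβ : (d : ℝ) / 2 + 1 < β) (hγ : 0 < γ) {ξ : Ω → Config (Euc d × ℝ)}
    (h : IsPoissonProcess (betaPrimeIntensity d β γ) ξ P) :
    ∀ᵐ ω ∂P, ∀ w : Euc d, ∃ y ∈ (ξ ω).pts, power w y < 0 := by
  have hβ' : ((d + 1 : ℕ) : ℝ) / 2 < β := by push_cast; linarith
  have hc := betaPrimeConst_pos (d + 1) hβ'
  suffices H : ∀ R : ℕ, ∀ᵐ ω ∂P, ∀ w : Euc d, (∀ i, |w i| ≤ R) → ∃ y ∈ (ξ ω).pts, power w y < 0 by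
    filter_upwards [ae_all_iff.2 H] with ω hω w
    obtain ⟨R, hR⟩ := exists_nat_ge ‖w‖
    exact hω R w fun i => (PiLp.norm_apply_le w i).trans hR
  intro R
  -- For cubes of side `1/n` and `t` of order `n⁻²`, the lower bound on the mass of a box has order
  -- `n^(-d) * t^(1-β)`, that is `n^p`; `p > 0` is exactly `β > d/2 + 1`.
  set p : ℝ := 2 * (β - 1) - d with hp
  have hp0 : 0 < p := by rw [hp]; linarith
  set K : ℝ := γ * betaPrimeConst (d + 1) β * (2 * ((d : ℝ) + 1)) ^ (-β) * ((d : ℝ) + 1) with hK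
  have hK0 : 0 < K := by positivity
  -- The union bound: `(2*R*n + 1)^d ≤ ((2*R + 1)*n)^d` cubes, each with an empty box with
  -- probability at most `exp (-(K * n^p))`.
  have hlim : Tendsto (fun n : ℕ => ENNReal.ofReal ((2 * (R : ℝ) + 1) ^ d *
      ((n : ℝ) ^ d * Real.exp (-(K * (n : ℝ) ^ p))))) atTop (𝓝 0) := by
    rw [← ENNReal.ofReal_zero]
    exact ENNReal.tendsto_ofReal (tendsto_pow_mul_exp_neg_rpow d hK0 hp0)
  rw [ae_iff]
  refine le_antisymm (ge_of_tendsto hlim ?_) zero_le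
  filter_upwards [eventually_gt_atTop 0] with n hn
  have hn0 : (0 : ℝ) < n := by exact_mod_cast hn
  have hn1 : (1 : ℝ) ≤ n := by exact_mod_cast hn
  -- Two points of a cube have squared distance at most `d / n²`, which is less than `t`. A process
  -- point over the cube of `w` with height below `-t` thus gives `w` negative power.
  set t : ℝ := ((d : ℝ) + 1) * (1 / (n : ℝ)) ^ 2 with ht
  have ht0 : 0 < t := by positivity
  let G : Finset (Fin d → ℤ) := Fintype.piFinset fun _ => Finset.Icc (-(R * n : ℕ) : ℤ) (R * n : ℕ)
  let A : (Fin d → ℤ) → Set (Euc d × ℝ) := fun k => gridCube n k ×ˢ Ioo (-(2 * t)) (-t)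
  have hA : ∀ k, MeasurableSet (A k) := fun k => (measurableSet_gridCube n k).prod measurableSet_Ioo
  have hpow : (1 / (n : ℝ)) ^ d * (γ * betaPrimeConst (d + 1) β * (2 * t) ^ (-β) * t)
      = K * (n : ℝ) ^ p := by
    have e1 : (1 / (n : ℝ)) ^ d = (n : ℝ) ^ (-(d : ℝ)) := by
      rw [one_div, inv_pow, ← Real.rpow_natCast, Real.rpow_neg hn0.le]
    have e2 : (1 / (n : ℝ)) ^ 2 = (n : ℝ) ^ (-2 : ℝ) := by
      rw [one_div, inv_pow, ← Real.rpow_natCast, Real.rpow_neg hn0.le]; norm_num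
    have e3 : (2 * t) ^ (-β) = (2 * ((d : ℝ) + 1)) ^ (-β) * (n : ℝ) ^ (2 * β) := by
      rw [ht, e2, ← mul_assoc, Real.mul_rpow (by positivity) (by positivity), ← Real.rpow_mul hn0.le]
      congr 2; ring
    rw [e3, ht, e1, e2, hp, show 2 * (β - 1) - (d : ℝ) = -(d : ℝ) + 2 * β + (-2) by ring,
      Real.rpow_add hn0, Real.rpow_add hn0, hK]
    ring
  have hprob : ∀ k, P {ω | (ξ ω).count (A k) = 0} ≤ ENNReal.ofReal (Real.exp (-(K * (n : ℝ) ^ p))) := by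
    intro k
    have e : {ω | (ξ ω).count (A k) = 0} = (fun ω => (ξ ω).count (A k)) ⁻¹' {0} := rfl
    rw [e, ← Measure.map_apply (h.measurable_count (hA k)) (MeasurableSet.of_discrete),
      h.law_count _ (hA k)]
    refine poissonLaw_zero_le ?_
    rw [← hpow, ENNReal.ofReal_mul (by positivity), ← volume_gridCube n k]
    exact le_betaPrimeIntensity_prod hβ' hγ ht0
  calc P {ω | ¬ ∀ w : Euc d, (∀ i, |w i| ≤ R) → ∃ y ∈ (ξ ω).pts, power w y < 0}
      ≤ P (⋃ k ∈ G, {ω | (ξ ω).count (A k) = 0}) := by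
        refine measure_mono fun ω hω => ?_
        simp only [mem_ofPred_eq, not_forall, not_exists, not_and, not_lt] at hω
        obtain ⟨w, hw, hy⟩ := hω
        refine mem_iUnion₂.2 ⟨fun i => ⌊(n : ℝ) * w i⌋, ?_, ?_⟩
        · rw [Fintype.mem_piFinset]
          intro i
          have hwi := abs_le.1 (hw i)
          rw [Finset.mem_Icc, Int.le_floor]
          refine ⟨?_, ?_⟩
          · push_cast
            nlinarith [hwi.1]
          · have h1 := Int.floor_le ((n : ℝ) * w i)
            have h2 : (⌊(n : ℝ) * w i⌋ : ℝ) ≤ ((R * n : ℕ) : ℤ) := by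
              push_cast
              nlinarith [hwi.2]
            exact_mod_cast h2
        · change (ξ ω).count _ = 0
          rw [Config.count_eq_zero]
          intro y hyξ hyA
          have h1 := norm_sub_sq_le_of_mem_gridCube hyA.1 (mem_gridCube_floor hn w)
          have h2 : y.2 < -t := hyA.2.2
          have h3 : 0 ≤ ‖w - y.1‖ ^ 2 + y.2 := hy y hyξ
          have h4 : 0 < (1 / (n : ℝ)) ^ 2 := by positivity
          rw [ht] at h2
          linarith
    _ ≤ ∑ k ∈ G, P {ω | (ξ ω).count (A k) = 0} := measure_biUnion_finset_le _ _
    _ ≤ ∑ k ∈ G, ENNReal.ofReal (Real.exp (-(K * (n : ℝ) ^ p))) := Finset.sum_le_sum fun k _ => hprob k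
    _ = ENNReal.ofReal ((2 * (R : ℝ) * n + 1) ^ d * Real.exp (-(K * (n : ℝ) ^ p))) := by
        rw [Finset.sum_const, Fintype.card_piFinset_const, Int.card_Icc, nsmul_eq_mul,
          ENNReal.ofReal_mul (by positivity)]
        congr 1
        rw [← ENNReal.ofReal_natCast]
        congr 1
        have : ((R * n : ℕ) + 1 - -((R * n : ℕ) : ℤ)).toNat = 2 * R * n + 1 := by
          have : ((R * n : ℕ) + 1 - -((R * n : ℕ) : ℤ)) = ((2 * R * n + 1 : ℕ) : ℤ) := by
            push_cast; ring
          rw [this, Int.toNat_natCast]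
        rw [this]
        push_cast; rfl
    _ ≤ _ := by
        refine ENNReal.ofReal_le_ofReal ?_
        rw [← mul_assoc, ← mul_pow]
        gcongr
        nlinarith

end Covering

/-! ### Equality in distribution for the three families -/

section Sections

variable {ℓ m : ℕ} {Ω Ω' : Type*} [MeasurableSpace Ω] [MeasurableSpace Ω']
  {P : Measure Ω} {P' : Measure Ω'}

/-- If the image of a Poisson process has the intensity of a second Poisson process, then the
Laguerre diagrams of the image and of the second process are identically distributed. -/
theorem IsPoissonProcess.identDistrib_laguerre_mapOn {S : Type*} [MeasurableSpace S]
    {μ : Measure S} {ξ : Ω → Config S} (h : IsPoissonProcess μ ξ P) {f : S → Euc ℓ × ℝ}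
    (hf : Measurable f) {τ : ℝ → ℝ≥0∞} {ν : Measure (Euc ℓ × ℝ)} [SigmaFinite ν]
    (hν : ν = volume.prod (volume.withDensity τ)) {U : Set (Euc ℓ × ℝ)} (hU : MeasurableSet U)
    (hfν : (μ.map f).restrict U = ν) {ξ' : Ω' → Config (Euc ℓ × ℝ)}
    (h' : IsPoissonProcess ν ξ' P') :
    IdentDistrib (fun ω => laguerre ((ξ ω).mapOn f U)) (fun ω => laguerre (ξ' ω)) P P' := by
  have hs : SigmaFinite ((μ.map f).restrict U) := hfν ▸ inferInstance
  obtain ⟨ζ, hζ, hae⟩ := h.mapOn hf hU measurable_snd fun c => by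
    rw [hfν, hν]; exact prod_withDensity_preimage_snd_singleton τ c
  rw [hfν] at hζ
  have hid := hζ.identDistrib_laguerre h'
  have hl : (fun ω => laguerre (ζ ω)) =ᵐ[P] fun ω => laguerre ((ξ ω).mapOn f U) := by
    filter_upwards [hae] with ω hω
    rw [hω]
  exact ⟨hid.aemeasurable_fst.congr hl, hid.aemeasurable_snd,
    (Measure.map_congr hl).symm.trans hid.map_eq⟩

theorem identDistrib_section_beta (hm : 1 ≤ m) {β γ : ℝ} (hβ : -1 ≤ β) (hγ : 0 < γ)
    {T : Ω → Collection (ℓ + m)} {T' : Ω' → Collection ℓ} (hT : IsBetaVoronoi (ℓ + m) β γ T P)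
    (hT' : IsBetaVoronoi ℓ (β + (m : ℝ) / 2) γ T' P') :
    IdentDistrib (fun ω => sectionWith ℓ (T ω)) T' P P' := by
  have hm0 : (0 : ℝ) < m := by exact_mod_cast hm
  obtain ⟨ξ', hξ', hTξ'⟩ : ∃ ξ' : Ω' → Config (Euc ℓ × ℝ),
      IsPoissonProcess (betaIntensity ℓ (β + (m : ℝ) / 2) γ) ξ' P' ∧ ∀ ω, T' ω = laguerre (ξ' ω) := by
    rcases hT' with ⟨h, -⟩ | ⟨-, h⟩
    -- The Voronoi alternative cannot occur for the section, as `β + m/2 > -1`.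
    · linarith
    · exact h
  rw [show T' = fun ω => laguerre (ξ' ω) from funext hTξ']
  rcases hT with ⟨rfl, ξ, hξ, hTξ⟩ | ⟨hβ', ξ, hξ, hTξ⟩
  · simp_rw [hTξ, sectionWith_voronoi]
    refine hξ.identDistrib_laguerre_mapOn (measurable_sectionPoint.comp (by fun_prop))
      (betaIntensity_eq_prod _ _ _) MeasurableSet.univ ?_ hξ'
    rw [Measure.restrict_univ]
    exact map_sectionPoint_voronoi hm hγ
  · simp_rw [hTξ, sectionWith_laguerre]
    refine hξ.identDistrib_laguerre_mapOn measurable_sectionPoint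
      (betaIntensity_eq_prod _ _ _) MeasurableSet.univ ?_ hξ'
    rw [Measure.restrict_univ, map_sectionPoint_betaIntensity hm hβ' hγ]

theorem identDistrib_section_betaPrime (hm : 1 ≤ m) {β γ : ℝ}
    (hβ : ((ℓ + m : ℕ) : ℝ) / 2 + 1 < β) (hγ : 0 < γ)
    {T : Ω → Collection (ℓ + m)} {T' : Ω' → Collection ℓ}
    (hT : IsBetaPrimeVoronoi (ℓ + m) β γ T P)
    (hT' : IsBetaPrimeVoronoi ℓ (β - (m : ℝ) / 2) γ T' P') :
    IdentDistrib (fun ω => sectionWith ℓ (T ω)) T' P P' := by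
  obtain ⟨ξ, hξ, hTξ⟩ := hT
  obtain ⟨ξ', hξ', hTξ'⟩ := hT'
  rw [show T' = fun ω => laguerre (ξ' ω) from funext hTξ']
  simp_rw [hTξ, sectionWith_laguerre]
  push_cast at hβ
  have hU : MeasurableSet {x : Euc ℓ × ℝ | x.2 < 0} :=
    measurableSet_lt measurable_snd measurable_const
  have hmap := map_sectionPoint_betaPrimeIntensity (ℓ := ℓ) hm (β := β) (by push_cast; linarith) hγ
  have hs : SigmaFinite (((betaPrimeIntensity (ℓ + m) β γ).map (sectionPoint ℓ m)).restrict
    {x | x.2 < 0}) := hmap ▸ inferInstance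
  obtain ⟨ζ, hζ, hae⟩ := hξ.mapOn measurable_sectionPoint hU measurable_snd fun c => by
    rw [hmap, betaPrimeIntensity_eq_prod]; exact prod_withDensity_preimage_snd_singleton _ c
  rw [hmap] at hζ
  -- In dimension `ℓ` the covering needs `β - m/2 > ℓ/2 + 1`, which is the hypothesis on `β` in
  -- dimension `ℓ + m`.
  have hcov := hζ.ae_forall_exists_power_neg (by linarith) hγ
  have hid := hξ.identDistrib_laguerre_mapOn measurable_sectionPoint
    (betaPrimeIntensity_eq_prod _ _ _) hU hmap hξ'
  have hl : (fun ω => laguerre ((ξ ω).mapOn (sectionPoint ℓ m) {x | x.2 < 0})) =ᵐ[P]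
      fun ω => laguerre ((ξ ω).mapOn (sectionPoint ℓ m) univ) := by
    filter_upwards [hae, hcov] with ω hω hcω
    rw [hω] at hcω
    exact (laguerre_eq_of_forall_power_neg (by simp [Config.mapOn]) hcω).symm
  exact ⟨hid.aemeasurable_fst.congr hl, hid.aemeasurable_snd,
    (Measure.map_congr hl).symm.trans hid.map_eq⟩

theorem identDistrib_laguerre_gaussian {d : ℕ} {lam γ γ' : ℝ} (hl : 0 < lam) (hγ : 0 < γ)
    (hγ' : 0 < γ') {ξ : Ω → Config (Euc d × ℝ)} {ξ' : Ω' → Config (Euc d × ℝ)}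
    (h : IsPoissonProcess (gaussianIntensity d lam γ) ξ P)
    (h' : IsPoissonProcess (gaussianIntensity d lam γ') ξ' P') :
    IdentDistrib (fun ω => laguerre (ξ ω)) (fun ω => laguerre (ξ' ω)) P P' := by
  -- The shift for which `γ * exp (-(lam * c)) = γ'`.
  set c := Real.log (γ / γ') / lam with hc
  have hcγ : γ * Real.exp (-(lam * c)) = γ' := by
    rw [hc, mul_div_cancel₀ _ hl.ne', Real.exp_neg, Real.exp_log (by positivity)]
    field_simp
  have := h.identDistrib_laguerre_mapOn (f := fun x => (x.1, x.2 + c)) (by fun_prop)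
    (gaussianIntensity_eq_prod d lam γ') MeasurableSet.univ
    (by rw [Measure.restrict_univ, map_shift_gaussianIntensity, hcγ]) h'
  simpa only [laguerre_mapOn_shift] using this

theorem identDistrib_section_gaussian (hm : 1 ≤ m) {lam : ℝ} (hl : 0 < lam)
    {T : Ω → Collection (ℓ + m)} {T' : Ω' → Collection ℓ}
    (hT : IsGaussianVoronoi (ℓ + m) lam T P) (hT' : IsGaussianVoronoi ℓ lam T' P') :
    IdentDistrib (fun ω => sectionWith ℓ (T ω)) T' P P' := by
  obtain ⟨γ, hγ, ξ, hξ, hTξ⟩ := hT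
  obtain ⟨γ', hγ', ξ', hξ', hTξ'⟩ := hT'
  rw [show T' = fun ω => laguerre (ξ' ω) from funext hTξ']
  simp_rw [hTξ, sectionWith_laguerre]
  obtain ⟨δ, hδ, hmap⟩ := map_sectionPoint_gaussianIntensity (ℓ := ℓ) hm hl hγ
  have hmap' : ((gaussianIntensity (ℓ + m) lam γ).map (sectionPoint ℓ m)).restrict univ
      = gaussianIntensity ℓ lam δ := by rw [Measure.restrict_univ, hmap]
  have hs : SigmaFinite (((gaussianIntensity (ℓ + m) lam γ).map (sectionPoint ℓ m)).restrict univ) :=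
    hmap' ▸ inferInstance
  obtain ⟨ζ, hζ, hae⟩ := hξ.mapOn measurable_sectionPoint MeasurableSet.univ measurable_snd
    fun c => by
      rw [hmap', gaussianIntensity_eq_prod]; exact prod_withDensity_preimage_snd_singleton _ c
  rw [hmap'] at hζ
  have hid := identDistrib_laguerre_gaussian hl hδ hγ' hζ hξ'
  have hl : (fun ω => laguerre (ζ ω)) =ᵐ[P]
      fun ω => laguerre ((ξ ω).mapOn (sectionPoint ℓ m) univ) := by
    filter_upwards [hae] with ω hω
    rw [hω]
  exact ⟨hid.aemeasurable_fst.congr hl, hid.aemeasurable_snd,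
    (Measure.map_congr hl).symm.trans hid.map_eq⟩

end Sections

end

theorem theorem1 (d ℓ : ℕ) (hd : 2 ≤ d) (hℓ : 1 ≤ ℓ) (hℓd : ℓ ≤ d - 1)
    {Ω Ω' : Type*} [MeasurableSpace Ω] [MeasurableSpace Ω']
    (P : Measure Ω) [IsProbabilityMeasure P] (P' : Measure Ω') [IsProbabilityMeasure P']
    (T : Ω → Collection d) (T' : Ω' → Collection ℓ) :
    (∀ β γ : ℝ, -1 ≤ β → 0 < γ →
      IsBetaVoronoi d β γ T P →
      IsBetaVoronoi ℓ (β + ((d : ℝ) - (ℓ : ℝ)) / 2) γ T' P' →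
      IdentDistrib (fun ω => sectionWith ℓ (T ω)) T' P P') ∧
    (∀ β γ : ℝ, (d : ℝ) / 2 + 1 < β → 0 < γ →
      IsBetaPrimeVoronoi d β γ T P →
      IsBetaPrimeVoronoi ℓ (β - ((d : ℝ) - (ℓ : ℝ)) / 2) γ T' P' →
      IdentDistrib (fun ω => sectionWith ℓ (T ω)) T' P P') ∧
    (∀ lam : ℝ, 0 < lam →
      IsGaussianVoronoi d lam T P →
      IsGaussianVoronoi ℓ lam T' P' →
      IdentDistrib (fun ω => sectionWith ℓ (T ω)) T' P P') := by
  obtain ⟨m, rfl⟩ := Nat.exists_eq_add_of_le (show ℓ ≤ d by omega)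
  have hm : 1 ≤ m := by omega
  have e : (((ℓ + m : ℕ) : ℝ) - (ℓ : ℝ)) / 2 = (m : ℝ) / 2 := by push_cast; ring
  refine ⟨fun β γ hβ hγ hT hT' => ?_, fun β γ hβ hγ hT hT' => ?_, fun lam hl hT hT' => ?_⟩
  · rw [e] at hT'
    exact identDistrib_section_beta hm hβ hγ hT hT'
  · rw [e] at hT'
    exact identDistrib_section_betaPrime hm hβ hγ hT hT'
  · exact identDistrib_section_gaussian hm hl hT hT'
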